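/- \textbf{Setting.} Let $V$ be a finite dimensional real Euclidean space with scalar product $(\cdot,\cdot)$, and let $R\subset V$ be a finite, reduced, irreducible, crystallographic root system, which need not span $V$ (for instance, the roots of the simple Lie algebra $[\mathfrak g,\mathfrak g]$ for a complex reductive Lie algebra $\mathfrak g$, with $V$ a real form of a Cartan subalgebra). Let $F$ be a base of $R$, $Q$ the root lattice, $\theta$ the highest root, and write $\alpha^\vee=2\alpha/(\alpha,\alpha)$. Let $Y\subset V$ be a lattice (a discrete subgroup, not necessarily of full rank) that contains all $\alpha^\vee$ ($\alpha\in R$) and satisfies $(Y,Q)\subseteq\mathbb Z$. Put $\widehat V=V\oplus\mathbb Rc\oplus\mathbb Rd$, $\widehat{\mathfrak h}=\mathbb C\otimes_{\mathbb R}\widehat V$ and $\widehat V^+=V\oplus\mathbb Rc\oplus\mathbb R_{>0}d$, and extend $(\cdot,\cdot)$ to a bilinear form by $(c,d)=1$, $(c,c)=(d,d)=0$, $(c,v)=(d,v)=0$ for $v\in V$. For $a\in\widehat V$ with $(a,a)\neq0$ let $a^\vee=2a/(a,a)$ and $s_a(\widehat v)=\widehat v-(\widehat v,a^\vee)a$;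 for $u\in V$ let $$t_u(v+\eta c+\xi d)=v+\xi u+\bigl(\eta-\tfrac{\xi}{2}(u,u)-(v,u)\bigr)c+\xi d .$$ Let $\widehat R=R+\mathbb Zc$, $\widehat F=F\cup\{-\theta+c\}$, and let $\widehat R^+$ be the set of elements of $\widehat R$ that are nonnegative integral combinations of $\widehat F$. Let $\widehat W^Y=W\ltimes Y$ be the group of isometries of $\widehat V$ generated by the $s_\alpha$ ($\alpha\in R$) and the $t_y$ ($y\in Y$); it contains $s_a$ for all $a\in\widehat R$. Let $\Omega=\{\omega\in\widehat W^Y:\omega(\widehat R^+)\subseteq\widehat R^+\}$. Let $k:\widehat R\to\mathbb C$ be $\widehat W^Y$-invariant. The extended trigonometric Cherednik algebra $\widehat H^Y(k)$ is the associative unital $\mathbb C$-algebra generated by the symmetric algebra $S(\widehat{\mathfrak h})$ and the group algebra $\mathbb C[\widehat W^Y]$, subject to the cross relations $$s_a\cdot\widehat v=s_a(\widehat v)\cdot s_a-k_a\,(a,\widehat v)\quad(a\in\widehat F),\qquad \omega\cdot\widehat v=\omega(\widehat v)\cdot\omega\quad(\omega\in\Omega),\qquad \widehat v\in\widehat{\mathfrak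 h}.$$ Let $C^\omega(\widehat V^+)$ be the space of complex valued real analytic functions on $\widehat V^+$, on which $w\in\widehat W^Y$ acts by $(wf)(\widehat v)=f(w^{-1}\widehat v)$, $\widehat v\in\widehat V$ acts by the directional derivative $\partial_{\widehat v}$, and, for $a\in\widehat R$, the integral-reflection operator $I(a)$ acts by $$(I(a)f)(\widehat v)=\int_0^{(a,\widehat v)}f(\widehat v-ta^\vee)\,dt .$$ \textbf{Theorem.} Let $M$ be a finite dimensional complex $\widehat W^Y$-module with representation map $\pi_M$. There exists a unique (unital) algebra homomorphism $$\widehat Q:\widehat H^Y(k)\to\mathrm{End}_{\mathbb C}\bigl(C^\omega(\widehat V^+)\otimes_{\mathbb C}M\bigr)$$ satisfying $$\widehat Q(s_a)=s_a\otimes\pi_M(s_a)-k_a\,I(a)\otimes\mathrm{Id}_M\quad(a\in\widehat F),$$ $$\widehat Q(\omega)=\omega\otimes\pi_M(\omega)\quad(\omega\in\Omega),\qquad \widehat Q(\widehat v)=\partial_{\widehat v}\otimes\mathrm{Id}_M\quad(\widehat v\in\widehat V).$$ -/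

import Mathlib

open scoped TensorProduct

noncomputable section

namespace ExtCherednik

/-! ## Integrals of analytic functions along lines -/

/-- The average of an analytic function over a continuous family of linear substitutions is
analytic. -/
theorem analyticAt_avg {E : Type*} [NormedAddCommGroup E] [NormedSpace ℝ E] {F : E → ℂ} {x : E}
    (hF : AnalyticAt ℝ F x) (A : ℝ → E →L[ℝ] E) (hA : Continuous A) :
    AnalyticAt ℝ (fun y => ∫ s in (0:ℝ)..1, F (x + A s y)) 0 := by
  obtain ⟨p, r, hp⟩ := hF
  obtain ⟨C, hC1, hC⟩ : ∃ C : ℝ, 1 ≤ C ∧ ∀ s ∈ Set.uIcc (0:ℝ) 1, ‖A s‖ ≤ C := by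
    obtain ⟨C, hC⟩ := (isCompact_uIcc (a := (0:ℝ)) (b := 1)).exists_bound_of_continuousOn
      hA.continuousOn
    exact ⟨max C 1, le_max_right _ _, fun s hs => (hC s hs).trans (le_max_left _ _)⟩
  have hC0 : 0 < C := by linarith
  obtain ⟨ρ', hρ'0, hρ'r⟩ := ENNReal.lt_iff_exists_nnreal_btwn.1 hp.r_pos
  have hρ'0 : 0 < ρ' := by exact_mod_cast hρ'0
  have hρ'rad : (ρ' : ENNReal) < p.radius := hρ'r.trans_le hp.r_le
  let B : ∀ n : ℕ, ℝ → ContinuousMultilinearMap ℝ (fun _ : Fin n => E) ℂ := fun n s =>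
    (p n).compContinuousLinearMap (fun _ => A s)
  have hBc : ∀ n, Continuous (B n) := by
    intro n
    have h := (ContinuousMultilinearMap.compContinuousLinearMapContinuousMultilinear ℝ
      (fun _ : Fin n => E) (fun _ : Fin n => E) ℂ).cont
    have h2 : Continuous fun s : ℝ => (ContinuousMultilinearMap.compContinuousLinearMapContinuousMultilinear ℝ
      (fun _ : Fin n => E) (fun _ : Fin n => E) ℂ) (fun _ => A s) :=
      h.comp (continuous_pi fun _ => hA)
    exact (ContinuousLinearMap.apply ℝ _ (p n)).continuous.comp h2
  have hBn : ∀ n, ∀ s ∈ Set.uIcc (0:ℝ) 1, ‖B n s‖ ≤ ‖p n‖ * C ^ n := by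
    intro n s hs
    refine ((p n).norm_compContinuousLinearMap_le _).trans ?_
    rw [Finset.prod_const, Finset.card_univ, Fintype.card_fin]
    gcongr
    exact hC s hs
  let q : FormalMultilinearSeries ℝ E ℂ := fun n => ∫ s in (0:ℝ)..1, B n s
  have hq : ∀ n, ‖q n‖ ≤ ‖p n‖ * C ^ n := by
    intro n
    have := intervalIntegral.norm_integral_le_of_norm_le_const (a := (0:ℝ)) (b := 1)
      (f := B n) (C := ‖p n‖ * C ^ n) (fun s hs => hBn n s (Set.uIoc_subset_uIcc hs))
    simpa using this
  let ρ : NNReal := ρ' / C.toNNReal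
  have hCnn : 0 < C.toNNReal := by simpa using hC0
  have hρ0 : 0 < ρ := div_pos hρ'0 hCnn
  have hρC : C * (ρ:ℝ) = ρ' := by
    simp only [ρ, NNReal.coe_div, Real.coe_toNNReal _ hC0.le]
    field_simp
  refine ⟨q, ρ, ?_, by exact_mod_cast hρ0, ?_⟩
  · obtain ⟨K, hK0, hK⟩ := p.norm_mul_pow_le_of_lt_radius hρ'rad
    refine q.le_radius_of_bound K fun n => ?_
    calc ‖q n‖ * (ρ:ℝ) ^ n ≤ ‖p n‖ * C ^ n * (ρ:ℝ) ^ n := by gcongr; exact hq n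
      _ = ‖p n‖ * (ρ':ℝ) ^ n := by rw [← hρC, mul_pow, mul_assoc]
      _ ≤ K := hK n
  · intro y hy
    have hy' : ‖y‖ < ρ := by
      simpa using hy
    have hAy : ∀ s ∈ Set.uIcc (0:ℝ) 1, ‖A s y‖ < ρ' := by
      intro s hs
      calc ‖A s y‖ ≤ ‖A s‖ * ‖y‖ := (A s).le_opNorm y
        _ ≤ C * ‖y‖ := by gcongr; exact hC s hs
        _ < C * ρ := by gcongr
        _ = ρ' := hρC
    have hsum : ∀ s ∈ Set.uIcc (0:ℝ) 1, HasSum (fun n => B n s (fun _ => y)) (F (x + A s y)) := by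
      intro s hs
      refine hp.hasSum ?_
      rw [Metric.mem_eball, edist_zero_right]
      refine lt_trans ?_ hρ'r
      rw [enorm_eq_nnnorm]
      exact_mod_cast hAy s hs
    have key := intervalIntegral.hasSum_integral_of_dominated_convergence (μ := MeasureTheory.volume)
        (a := (0:ℝ)) (b := 1) (F := fun n s => B n s (fun _ => y)) (f := fun s => F (x + A s y))
      (fun n _ => ‖p n‖ * (C * ‖y‖) ^ n) (fun n => ?_) (fun n => ?_) ?_ ?_ ?_
    · rw [zero_add]
      convert key using 2 with n
      have := ((ContinuousMultilinearMap.apply ℝ (fun _ : Fin n => E) ℂ (fun _ => y)).intervalIntegral_comp_comm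
        ((hBc n).intervalIntegrable (μ := MeasureTheory.volume) 0 1))
      exact this.symm
    · exact ((ContinuousMultilinearMap.apply ℝ (fun _ : Fin n => E) ℂ (fun _ => y)).continuous.comp
        (hBc n)).aestronglyMeasurable
    · refine Filter.Eventually.of_forall fun s hs => ?_
      refine ((B n s).le_opNorm _).trans ?_
      rw [Finset.prod_const, Finset.card_univ, Fintype.card_fin, mul_pow, ← mul_assoc]
      gcongr
      exact hBn n s (Set.uIoc_subset_uIcc hs)
    · refine Filter.Eventually.of_forall fun s hs => ?_
      have h1 : C * ‖y‖ < ρ' := by rw [← hρC]; gcongr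
      have h2 : ((C * ‖y‖).toNNReal : ENNReal) < p.radius := by
        refine lt_trans ?_ hρ'rad
        rw [ENNReal.coe_lt_coe, Real.toNNReal_lt_iff_lt_coe (by positivity)]
        exact h1
      have h3 := p.summable_norm_mul_pow h2
      rwa [Real.coe_toNNReal _ (by positivity)] at h3
    · exact intervalIntegrable_const
    · exact Filter.Eventually.of_forall fun s hs => hsum s (Set.uIoc_subset_uIcc hs)

/-- An analytic function has locally an analytic antiderivative in the direction `w`. -/
theorem exists_dirAntideriv {E : Type*} [NormedAddCommGroup E] [NormedSpace ℝ E] {F : E → ℂ} {x : E}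
    (hF : AnalyticAt ℝ F x) (w : E) (φ : E →L[ℝ] ℝ) (hφ : φ w = 1) :
    ∃ G : E → ℂ, AnalyticAt ℝ G x ∧
      ∀ᶠ z in nhds x, HasDerivAt (fun t : ℝ => G (z + t • w)) (F z) 0 := by
  let A : ℝ → E →L[ℝ] E := fun s => ContinuousLinearMap.id ℝ E - s • φ.smulRight w
  have hA : Continuous A := by fun_prop
  have h1 := analyticAt_avg hF A hA
  let J : E → ℂ := fun y => ∫ s in (0:ℝ)..1, F (x + A s y)
  refine ⟨fun z => φ (z - x) • J (z - x), ?_, ?_⟩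
  · have h2 : AnalyticAt ℝ (fun z : E => z - x) x := analyticAt_id.sub analyticAt_const
    have h3 : AnalyticAt ℝ (fun z => J (z - x)) x := by
      refine AnalyticAt.fun_comp (g := J) ?_ h2
      rw [sub_self]
      exact h1
    have h4 : AnalyticAt ℝ (fun z => φ (z - x)) x := (φ.analyticAt _).fun_comp h2
    exact h4.smul h3
  · obtain ⟨r, hr, hball⟩ := hF.exists_ball_analyticOnNhd
    have hcont : ContinuousOn F (Metric.ball x r) := hball.continuousOn
    have hev : ∀ᶠ z in nhds x, ‖z - x‖ + |φ (z - x)| * ‖w‖ < r := by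
      have hc : Continuous fun z : E => ‖z - x‖ + |φ (z - x)| * ‖w‖ := by fun_prop
      have : (fun z : E => ‖z - x‖ + |φ (z - x)| * ‖w‖) x < r := by simpa using hr
      exact hc.continuousAt.eventually_lt continuousAt_const this
    filter_upwards [hev] with z hz
    set c := φ (z - x) with hc
    have hform : ∀ t : ℝ, φ (z + t • w - x) • J (z + t • w - x)
        = ∫ σ in (-c)..t, F (z + σ • w) := by
      intro t
      have e1 : φ (z + t • w - x) = c + t := by
        rw [add_sub_right_comm, map_add, map_smul, hφ]; simp [hc]
      have e2 := intervalIntegral.smul_integral_comp_sub_mul (fun σ => F (z + σ • w)) (c + t) t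
        (a := 0) (b := 1)
      rw [e1]
      have e3 : t - (c + t) * 1 = -c := by ring
      have e4 : t - (c + t) * 0 = t := by ring
      rw [e3, e4] at e2
      rw [← e2]
      congr 1
      refine intervalIntegral.integral_congr fun s _ => ?_
      simp only [A, sub_apply, ContinuousLinearMap.id_apply,
        smul_apply, ContinuousLinearMap.smulRight_apply, e1]
      congr 1
      module
    simp only [hform]
    have hmem : ∀ σ ∈ Set.uIcc (-c) 0, z + σ • w ∈ Metric.ball x r := by
      intro σ hσ
      have hσ' : |σ| ≤ |c| := by
        have := Set.abs_sub_right_of_mem_uIcc hσ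
        simpa using this
      rw [Metric.mem_ball, dist_eq_norm, add_sub_right_comm]
      calc ‖z - x + σ • w‖ ≤ ‖z - x‖ + ‖σ • w‖ := norm_add_le _ _
        _ = ‖z - x‖ + |σ| * ‖w‖ := by rw [norm_smul, Real.norm_eq_abs]
        _ ≤ ‖z - x‖ + |c| * ‖w‖ := by gcongr
        _ < r := hz
    have hline : Continuous fun σ : ℝ => z + σ • w := by fun_prop
    have hint : IntervalIntegrable (fun σ : ℝ => F (z + σ • w)) MeasureTheory.volume (-c) 0 :=
      (hcont.comp hline.continuousOn hmem).intervalIntegrable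
    have h0 : z + (0:ℝ) • w ∈ Metric.ball x r := hmem 0 Set.right_mem_uIcc
    have hco : ContinuousOn (fun σ : ℝ => F (z + σ • w))
        ((fun σ : ℝ => z + σ • w) ⁻¹' Metric.ball x r) :=
      hcont.comp hline.continuousOn (Set.mapsTo_preimage _ _)
    have hop : IsOpen ((fun σ : ℝ => z + σ • w) ⁻¹' Metric.ball x r) :=
      Metric.isOpen_ball.preimage hline
    have := intervalIntegral.integral_hasDerivAt_right hint
      (hco.stronglyMeasurableAtFilter hop 0 h0) (hco.continuousAt (hop.mem_nhds h0))
    simpa using this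

theorem analyticAt_lineIntegral {E : Type*} [NormedAddCommGroup E] [NormedSpace ℝ E] {F : E → ℂ}
    {u₀ : E} (w : E) (φ : E →L[ℝ] ℝ) (hφ : φ w = 1) (ℓ : E →L[ℝ] ℝ)
    (hF : ∀ τ : ℝ, AnalyticAt ℝ F (u₀ - τ • w)) :
    AnalyticAt ℝ (fun u => ∫ t in (0:ℝ)..(ℓ u), F (u - t • w)) u₀ := by
  have hopen : IsOpen {x | AnalyticAt ℝ F x} := isOpen_analyticAt ℝ F
  have hint : ∀ τ₀ : ℝ, ∀ᶠ u in nhds u₀,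
      IntervalIntegrable (fun t : ℝ => F (u - t • w)) MeasureTheory.volume 0 τ₀ := by
    intro τ₀
    have hk : IsCompact (Set.uIcc (0:ℝ) τ₀) := isCompact_uIcc
    have := hk.eventually_forall_of_forall_eventually (x₀ := u₀)
      (P := fun u t => AnalyticAt ℝ F (u - t • w)) (fun t _ => by
        have hc : Continuous fun z : E × ℝ => z.1 - z.2 • w := by fun_prop
        exact hc.continuousAt.eventually (hopen.mem_nhds (hF t)))
    filter_upwards [this] with u hu
    refine ContinuousOn.intervalIntegrable fun t ht => ?_
    have h1 : Continuous fun t : ℝ => u - t • w := by fun_prop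
    exact (ContinuousAt.comp (f := fun t : ℝ => u - t • w) (hu t ht).continuousAt
      h1.continuousAt).continuousWithinAt
  have key : ∀ τ₀ : ℝ, ∃ G : E → ℂ, AnalyticAt ℝ G (u₀ - τ₀ • w) ∧
      ∀ᶠ z : ℝ × E in nhds (τ₀, u₀), (∫ t in (0:ℝ)..z.1, F (z.2 - t • w)) =
        (∫ t in (0:ℝ)..τ₀, F (z.2 - t • w)) + (G (z.2 - τ₀ • w) - G (z.2 - z.1 • w)) := by
    intro τ₀
    obtain ⟨G, hG, hd⟩ := exists_dirAntideriv (hF τ₀) w φ hφ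
    refine ⟨G, hG, ?_⟩
    have hc : Continuous fun z : ℝ × E => z.2 - z.1 • w := by fun_prop
    have hev : ∀ᶠ z : ℝ × E in nhds (τ₀, u₀),
        HasDerivAt (fun t : ℝ => G (z.2 - z.1 • w + t • w)) (F (z.2 - z.1 • w)) 0 ∧
          AnalyticAt ℝ F (z.2 - z.1 • w) :=
      (hc.continuousAt (x := (τ₀, u₀))).eventually
        (p := fun z' => HasDerivAt (fun t : ℝ => G (z' + t • w)) (F z') 0 ∧ AnalyticAt ℝ F z')
        (hd.and (hopen.mem_nhds (hF τ₀)))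
    rw [nhds_prod_eq, Filter.eventually_prod_iff] at hev
    obtain ⟨p, hp, q, hq, hpq⟩ := hev
    obtain ⟨ε, hε, hball⟩ := Metric.eventually_nhds_iff_ball.1 hp
    rw [nhds_prod_eq, Filter.eventually_prod_iff]
    refine ⟨fun τ => τ ∈ Metric.ball τ₀ ε, Metric.ball_mem_nhds _ hε, _, hq.and (hint τ₀), ?_⟩
    rintro τ hτ u ⟨hu, hui⟩
    have hsub : ∀ t ∈ Set.uIcc τ₀ τ, p t := by
      intro t ht
      refine hball t ((convex_ball τ₀ ε).ordConnected.uIcc_subset (Metric.mem_ball_self hε) hτ ht)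
    have hder : ∀ t ∈ Set.uIcc τ₀ τ, HasDerivAt (fun t : ℝ => -G (u - t • w)) (F (u - t • w)) t := by
      intro t ht
      have h1 := (hpq (hsub t ht) hu).1
      have h2 : HasDerivAt (fun s : ℝ => t - s) (-1) t := by
        simpa using (hasDerivAt_id t).const_sub t
      have h3 : HasDerivAt (fun s : ℝ => G (u - t • w + s • w)) (F (u - t • w)) (t - t) := by
        rw [sub_self]; exact h1
      have h4 := (HasDerivAt.scomp t h3 h2).neg
      refine (h4.congr_deriv (by simp)).congr_of_eventuallyEq (Filter.Eventually.of_forall fun s => ?_)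
      simp only [Pi.neg_apply, Function.comp]
      congr 2
      module
    have hii : IntervalIntegrable (fun t : ℝ => F (u - t • w)) MeasureTheory.volume τ₀ τ := by
      refine ContinuousOn.intervalIntegrable fun t ht => ?_
      have h1 : Continuous fun t : ℝ => u - t • w := by fun_prop
      exact (ContinuousAt.comp (f := fun t : ℝ => u - t • w) (hpq (hsub t ht) hu).2.continuousAt
        h1.continuousAt).continuousWithinAt
    have hftc := intervalIntegral.integral_eq_sub_of_hasDerivAt hder hii
    have hadd := intervalIntegral.integral_add_adjacent_intervals hui hii
    simp only
    rw [← hadd, hftc]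
    ring
  have hsubw : ∀ τ : ℝ, AnalyticAt ℝ (fun u : E => u - τ • w) u₀ := fun τ =>
    analyticAt_id.sub analyticAt_const
  have hP : ∀ τ : ℝ, AnalyticAt ℝ (fun u => ∫ t in (0:ℝ)..τ, F (u - t • w)) u₀ := by
    let P : ℝ → Prop := fun τ => AnalyticAt ℝ (fun u => ∫ t in (0:ℝ)..τ, F (u - t • w)) u₀
    have hloc : IsLocallyConstant P := by
      rw [IsLocallyConstant.iff_eventually_eq]
      intro τ₀
      obtain ⟨G, hG, hev⟩ := key τ₀
      have hGnear : ∀ᶠ τ : ℝ in nhds τ₀, AnalyticAt ℝ G (u₀ - τ • w) := by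
        have hc : Continuous fun τ : ℝ => u₀ - τ • w := by fun_prop
        exact hc.continuousAt.eventually ((isOpen_analyticAt ℝ G).mem_nhds hG)
      rw [nhds_prod_eq] at hev
      filter_upwards [hGnear, hev.curry] with τ hτ hτu
      have hGd : AnalyticAt ℝ (fun u => G (u - τ₀ • w) - G (u - τ • w)) u₀ :=
        (AnalyticAt.fun_comp (g := G) (f := fun u : E => u - τ₀ • w) hG (hsubw τ₀)).sub
          (AnalyticAt.fun_comp (g := G) (f := fun u : E => u - τ • w) hτ (hsubw τ))
      refine propext ⟨fun h => ?_, fun h => ?_⟩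
      · refine (h.sub hGd).congr ?_
        filter_upwards [hτu] with u hu
        simp only [Pi.sub_apply, hu]
        ring
      · refine (h.add hGd).congr ?_
        filter_upwards [hτu] with u hu
        simp only [Pi.add_apply, hu]
    intro τ
    have h0 : P 0 := by
      simp only [P, intervalIntegral.integral_same]
      exact analyticAt_const
    have := hloc.apply_eq_of_isPreconnected isPreconnected_univ (Set.mem_univ 0) (Set.mem_univ τ)
    exact (iff_of_eq this).mp h0
  obtain ⟨G, hG, hev⟩ := key (ℓ u₀)
  have hA2 : AnalyticAt ℝ (fun u : E => u - ℓ u • w) u₀ :=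
    analyticAt_id.sub ((ℓ.analyticAt u₀).smul analyticAt_const)
  have hmain : AnalyticAt ℝ (fun u => (∫ t in (0:ℝ)..(ℓ u₀), F (u - t • w)) +
      (G (u - ℓ u₀ • w) - G (u - ℓ u • w))) u₀ :=
    (hP _).add ((AnalyticAt.fun_comp (g := G) (f := fun u : E => u - ℓ u₀ • w) hG (hsubw _)).sub (AnalyticAt.fun_comp (g := G) (f := fun u : E => u - ℓ u • w) hG hA2))
  refine hmain.congr ?_
  have hc : Filter.Tendsto (fun u : E => (ℓ u, u)) (nhds u₀) (nhds (ℓ u₀, u₀)) := by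
    have : Continuous fun u : E => (ℓ u, u) := by fun_prop
    exact this.continuousAt
  filter_upwards [hc.eventually hev] with u hu
  exact hu.symm

/-! ## The space `V̂ = V ⊕ ℝ c ⊕ ℝ d` and its isometries -/

/-- `V̂ = V ⊕ ℝ c ⊕ ℝ d`; the triple `(v, η, ξ)` stands for `v + η c + ξ d`. -/
abbrev VHat (V : Type*) := V × ℝ × ℝ

/-- `ĥ = h ⊕ ℂ c ⊕ ℂ d`, the complexification of `V̂`. -/
abbrev HHat (V : Type*) [AddCommGroup V] [Module ℝ V] := ℂ ⊗[ℝ] VHat V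

section Space

variable {V : Type*} [NormedAddCommGroup V] [InnerProductSpace ℝ V]

/-- The bilinear form on `V̂` that extends the scalar product of `V`, with `(c, d) = 1`,
`(c, c) = (d, d) = 0` and `c`, `d` orthogonal to `V`. -/
def form : VHat V →ₗ[ℝ] VHat V →ₗ[ℝ] ℝ :=
  LinearMap.mk₂ ℝ (fun x y => inner ℝ x.1 y.1 + x.2.1 * y.2.2 + x.2.2 * y.2.1)
    (fun x x' y => by simp only [Prod.fst_add, Prod.snd_add, inner_add_left]; ring)
    (fun r x y => by
      simp only [Prod.smul_fst, Prod.smul_snd, real_inner_smul_left, smul_eq_mul]; ring)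
    (fun x y y' => by simp only [Prod.fst_add, Prod.snd_add, inner_add_right]; ring)
    (fun r x y => by
      simp only [Prod.smul_fst, Prod.smul_snd, real_inner_smul_right, smul_eq_mul]; ring)

theorem form_apply (x y : VHat V) :
    form x y = inner ℝ x.1 y.1 + x.2.1 * y.2.2 + x.2.2 * y.2.1 := rfl

theorem form_comm (x y : VHat V) : form x y = form y x := by
  simp only [form_apply, real_inner_comm x.1 y.1]; ring

/-- The complex linear functional `(a, ·)` on `ĥ`, for `a ∈ V̂`. -/
def formC (a : VHat V) : HHat V →ₗ[ℂ] ℂ :=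
  (TensorProduct.AlgebraTensorModule.rid ℝ ℂ ℂ).toLinearMap ∘ₗ (form a).baseChange ℂ

/-- `a^∨ = 2 a / (a, a)`. -/
def coroot (a : VHat V) : VHat V := (2 / form a a) • a

theorem form_coroot_smul (a v : VHat V) : form v (coroot a) • a = form a v • coroot a := by
  simp only [coroot, map_smul, smul_smul, smul_eq_mul, form_comm v a, mul_comm]

/-- The reflection `s_a v̂ = v̂ - (v̂, a^∨) a`. -/
def refl (a : VHat V) : VHat V ≃ₗ[ℝ] VHat V :=
  LinearEquiv.ofInvolutive
    (LinearMap.id - ((form.flip (coroot a)).smulRight a)) (fun v => by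
      have h : form v (coroot a) • a - (form v (coroot a) * form a (coroot a)) • a =
          -(form v (coroot a) • a) := by
        by_cases h0 : form a a = 0
        · simp [coroot, h0]
        · have : form a (coroot a) = 2 := by
            simp only [coroot, map_smul, smul_eq_mul]; field_simp
          rw [this, mul_two, add_smul]; abel
      simp only [LinearMap.sub_apply, LinearMap.id_apply, LinearMap.smulRight_apply,
        LinearMap.flip_apply, map_sub, map_smul, smul_sub, smul_smul]
      rw [h]
      abel)

theorem refl_apply (a v : VHat V) : refl a v = v - form v (coroot a) • a := rfl

/-- The underlying map of the transvection `t_u`, `u ∈ V`: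
`t_u (v + η c + ξ d) = v + ξ u + (η - (ξ / 2) (u, u) - (v, u)) c + ξ d`. -/
def translLin (u : V) : VHat V →ₗ[ℝ] VHat V where
  toFun x := (x.1 + x.2.2 • u, x.2.1 - x.2.2 / 2 * inner ℝ u u - inner ℝ x.1 u, x.2.2)
  map_add' x y := by
    ext
    · simp only [Prod.fst_add, Prod.snd_add]; module
    · simp only [Prod.fst_add, Prod.snd_add, inner_add_left]; ring
    · simp
  map_smul' r x := by
    ext
    · simp only [Prod.smul_fst, Prod.smul_snd, smul_eq_mul, RingHom.id_apply]; module
    · simp only [Prod.smul_fst, Prod.smul_snd, real_inner_smul_left, smul_eq_mul,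
        RingHom.id_apply]; ring
    · simp

theorem translLin_neg (u : V) (x : VHat V) : translLin (-u) (translLin u x) = x := by
  ext
  · simp only [translLin, LinearMap.coe_mk, AddHom.coe_mk]; module
  · simp only [translLin, LinearMap.coe_mk, AddHom.coe_mk, inner_neg_right, inner_neg_left,
      inner_add_left, real_inner_smul_left]; ring
  · simp [translLin]

/-- The isometry `t_u` of `V̂`, for `u ∈ V`. -/
def transl (u : V) : VHat V ≃ₗ[ℝ] VHat V :=
  LinearEquiv.ofLinearMap (translLin u) (translLin (-u))
    (LinearMap.ext fun x => by simpa using translLin_neg (-u) x)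
    (LinearMap.ext fun x => translLin_neg u x)

theorem transl_apply (u : V) (x : VHat V) : transl u x =
    (x.1 + x.2.2 • u, x.2.1 - x.2.2 / 2 * inner ℝ u u - inner ℝ x.1 u, x.2.2) := rfl

end Space

/-! ## Root systems, affine root systems and the extended affine Weyl group -/

/-- `R` is a finite, reduced, irreducible, crystallographic root system in the Euclidean
space `V`, which need not span `V`. -/
structure IsIrreducibleRootSystem {V : Type*} [NormedAddCommGroup V] [InnerProductSpace ℝ V]
    (R : Set V) : Prop where
  finite : R.Finite
  nonempty : R.Nonempty
  zero_notMem : (0 : V) ∉ R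
  reflection_mem : ∀ α ∈ R, ∀ β ∈ R, β - (2 * inner ℝ β α / inner ℝ α α) • α ∈ R
  crystallographic : ∀ α ∈ R, ∀ β ∈ R, ∃ m : ℤ, 2 * inner ℝ β α / inner ℝ α α = (m : ℝ)
  reduced : ∀ α ∈ R, ∀ r : ℝ, r • α ∈ R → r = 1 ∨ r = -1
  irreducible : ∀ S ⊆ R, S.Nonempty → (∀ α ∈ S, ∀ β ∈ R \ S, inner ℝ α β = 0) → S = R

/-- The data on which the extended trigonometric Cherednik algebra depends (apart from the
multiplicity function): an irreducible root system `R` in `V`, a base `F` of `R` and a lattice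
`Y` in `V` that contains the coroot lattice and satisfies `(Y, Q) ⊆ ℤ` for the root lattice `Q`.
The lattice `Y` need not have full rank. -/
structure AffineData (V : Type*) [NormedAddCommGroup V] [InnerProductSpace ℝ V] where
  /-- the roots -/
  R : Set V
  isRootSystem : IsIrreducibleRootSystem R
  /-- the simple roots -/
  F : Set V
  F_subset : F ⊆ R
  F_linearIndependent : LinearIndependent ℝ (Subtype.val : F → V)
  F_base : ∀ α ∈ R, α ∈ AddSubmonoid.closure F ∨ -α ∈ AddSubmonoid.closure F
  /-- the lattice of translations -/
  Y : AddSubgroup V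
  Y_discrete : DiscreteTopology Y
  coroot_mem_Y : ∀ α ∈ R, (2 / inner ℝ α α : ℝ) • α ∈ Y
  Y_integral : ∀ y ∈ Y, ∀ α ∈ R, ∃ m : ℤ, inner ℝ y α = (m : ℝ)

namespace AffineData

variable {V : Type*} [NormedAddCommGroup V] [InnerProductSpace ℝ V] (D : AffineData V)

/-- The affine root system `R̂ = R + ℤ c`. -/
def affineRoots : Set (VHat V) := {a | a.1 ∈ D.R ∧ (∃ m : ℤ, a.2.1 = (m : ℝ)) ∧ a.2.2 = 0}

/-- `θ` is the highest root: `θ - α` is a nonnegative integral combination of simple roots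
for every root `α`. -/
def IsHighestRoot (θ : V) : Prop := θ ∈ D.R ∧ ∀ α ∈ D.R, θ - α ∈ AddSubmonoid.closure D.F

/-- The simple affine roots `F̂ = {a₀} ∪ F` with `a₀ = -θ + c`. -/
def simpleAffineRoots : Set (VHat V) :=
  {a | ∃ α ∈ D.F, a = (α, 0, 0)} ∪ {a | ∃ θ, D.IsHighestRoot θ ∧ a = (-θ, 1, 0)}

/-- The positive affine roots: those that are nonnegative integral combinations of `F̂`. -/
def positiveAffineRoots : Set (VHat V) :=
  {a | a ∈ D.affineRoots ∧ a ∈ AddSubmonoid.closure D.simpleAffineRoots}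

/-- The extended affine Weyl group `Ŵ^Y = W ⋉ Y`, realized on `V̂`: the group of isometries
generated by the Weyl group `W` of `R` and the transvections `t_y`, `y ∈ Y`. -/
def extWeyl : Subgroup (VHat V ≃ₗ[ℝ] VHat V) :=
  Subgroup.closure ({g | ∃ α ∈ D.R, g = refl (α, 0, 0)} ∪ {g | ∃ y ∈ D.Y, g = transl y})

/-- `Ω`: the elements of `Ŵ^Y` that map positive affine roots to positive affine roots. -/
def Omega : Set D.extWeyl :=
  {w | ∀ a ∈ D.positiveAffineRoots, (w : VHat V ≃ₗ[ℝ] VHat V) a ∈ D.positiveAffineRoots}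

variable {D}

theorem inner_self_ne_zero_of_mem {a : VHat V} (ha : a ∈ D.affineRoots) :
    (inner ℝ a.1 a.1 : ℝ) ≠ 0 := fun h =>
  D.isRootSystem.zero_notMem ((inner_self_eq_zero (𝕜 := ℝ)).1 h ▸ ha.1)

theorem form_self_eq {a : VHat V} (ha : a ∈ D.affineRoots) : form a a = inner ℝ a.1 a.1 := by
  simp [form_apply, ha.2.2]

theorem form_self_ne_zero {a : VHat V} (ha : a ∈ D.affineRoots) : form a a ≠ 0 := by
  rw [form_self_eq ha]; exact inner_self_ne_zero_of_mem ha

theorem coroot_snd_snd {a : VHat V} (ha : a ∈ D.affineRoots) : (coroot a).2.2 = 0 := by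
  simp [coroot, ha.2.2]

theorem refl_mem_extWeyl {a : VHat V} (ha : a ∈ D.affineRoots) : refl a ∈ D.extWeyl := by
  obtain ⟨α, η, ξ⟩ := a
  obtain ⟨hα, ⟨m, hm⟩, hξ⟩ := ha
  simp only at hα hm hξ
  subst hm hξ
  have hne : (inner ℝ α α : ℝ) ≠ 0 := fun h =>
    D.isRootSystem.zero_notMem ((inner_self_eq_zero (𝕜 := ℝ)).1 h ▸ hα)
  have key : refl (α, (m : ℝ), (0 : ℝ)) =
      refl (α, 0, 0) * transl (m • ((2 / inner ℝ α α : ℝ) • α)) := by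
    ext x
    · simp only [LinearEquiv.mul_apply, refl_apply, transl_apply, coroot, form_apply, Prod.fst_sub,
        Prod.smul_fst, Prod.smul_snd, smul_eq_mul, ← Int.cast_smul_eq_zsmul ℝ, inner_add_left,
        inner_smul_left, inner_smul_right, smul_smul]
      generalize (inner ℝ α α : ℝ) = c at hne
      generalize (inner ℝ x.1 α : ℝ) = e
      match_scalars
      · simp
      · simp
        field_simp
        ring
    · simp only [LinearEquiv.mul_apply, refl_apply, transl_apply, coroot, form_apply, Prod.fst_sub,
        Prod.snd_sub, Prod.smul_fst, Prod.smul_snd, smul_eq_mul, ← Int.cast_smul_eq_zsmul ℝ,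
        inner_smul_left, inner_smul_right, smul_smul, inner_add_left]
      generalize (inner ℝ α α : ℝ) = c at hne
      generalize (inner ℝ x.1 α : ℝ) = e
      simp
      field_simp
      ring
    · simp [LinearEquiv.mul_apply, refl_apply, transl_apply]
  rw [key]
  refine Subgroup.mul_mem _ (Subgroup.subset_closure (Or.inl ⟨α, hα, rfl⟩))
    (Subgroup.subset_closure (Or.inr ⟨_, D.Y.zsmul_mem (D.coroot_mem_Y α hα) m, rfl⟩))

variable (D) in
/-- The reflection `s_a` as an element of `Ŵ^Y`, for an affine root `a`. -/
def affRefl (a : D.affineRoots) : D.extWeyl := ⟨refl a.1, refl_mem_extWeyl a.2⟩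

/-- `k : R̂ → ℂ` is a multiplicity function, that is, `Ŵ^Y`-invariant. -/
def IsMultiplicity (k : D.affineRoots → ℂ) : Prop :=
  ∀ (w : D.extWeyl) (a b : D.affineRoots), (w : VHat V ≃ₗ[ℝ] VHat V) a = b → k a = k b

/-! ## The extended trigonometric Cherednik algebra -/

/-- The defining relations of the extended trigonometric Cherednik algebra on the generators
`x ∈ ĥ` and `w ∈ Ŵ^Y`: the relations of the symmetric algebra `S(ĥ)`, the relations of the
group algebra `ℂ[Ŵ^Y]`, and the cross relations. -/
inductive CherednikRel (k : D.affineRoots → ℂ) :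
    FreeAlgebra ℂ (HHat V ⊕ D.extWeyl) → FreeAlgebra ℂ (HHat V ⊕ D.extWeyl) → Prop
  | vec_add (x y : HHat V) : CherednikRel k (FreeAlgebra.ι ℂ (Sum.inl (x + y)))
      (FreeAlgebra.ι ℂ (Sum.inl x) + FreeAlgebra.ι ℂ (Sum.inl y))
  | vec_smul (r : ℂ) (x : HHat V) : CherednikRel k (FreeAlgebra.ι ℂ (Sum.inl (r • x)))
      (r • FreeAlgebra.ι ℂ (Sum.inl x))
  | vec_comm (x y : HHat V) : CherednikRel k
      (FreeAlgebra.ι ℂ (Sum.inl x) * FreeAlgebra.ι ℂ (Sum.inl y))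
      (FreeAlgebra.ι ℂ (Sum.inl y) * FreeAlgebra.ι ℂ (Sum.inl x))
  | grp_one : CherednikRel k (FreeAlgebra.ι ℂ (Sum.inr 1)) 1
  | grp_mul (w w' : D.extWeyl) : CherednikRel k (FreeAlgebra.ι ℂ (Sum.inr (w * w')))
      (FreeAlgebra.ι ℂ (Sum.inr w) * FreeAlgebra.ι ℂ (Sum.inr w'))
  | cross_refl (a : D.affineRoots) (ha : (a : VHat V) ∈ D.simpleAffineRoots) (x : HHat V) :
      CherednikRel k
        (FreeAlgebra.ι ℂ (Sum.inr (D.affRefl a)) * FreeAlgebra.ι ℂ (Sum.inl x))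
        (FreeAlgebra.ι ℂ (Sum.inl ((refl (a : VHat V)).toLinearMap.baseChange ℂ x)) *
            FreeAlgebra.ι ℂ (Sum.inr (D.affRefl a)) -
          algebraMap ℂ _ (k a * formC (a : VHat V) x))
  | cross_Omega (w : D.extWeyl) (hw : w ∈ D.Omega) (x : HHat V) : CherednikRel k
      (FreeAlgebra.ι ℂ (Sum.inr w) * FreeAlgebra.ι ℂ (Sum.inl x))
      (FreeAlgebra.ι ℂ (Sum.inl ((w : VHat V ≃ₗ[ℝ] VHat V).toLinearMap.baseChange ℂ x)) *
        FreeAlgebra.ι ℂ (Sum.inr w))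

/-- The extended trigonometric Cherednik algebra `Ĥ^Y(k)`. -/
def Cherednik (k : D.affineRoots → ℂ) : Type _ := RingQuot (CherednikRel k)

instance (k : D.affineRoots → ℂ) : Ring (Cherednik k) :=
  inferInstanceAs (Ring (RingQuot (CherednikRel k)))

instance (k : D.affineRoots → ℂ) : Algebra ℂ (Cherednik k) :=
  inferInstanceAs (Algebra ℂ (RingQuot (CherednikRel k)))

namespace Cherednik

variable (k : D.affineRoots → ℂ)

/-- The quotient map from the free algebra. -/
def mk : FreeAlgebra ℂ (HHat V ⊕ D.extWeyl) →ₐ[ℂ] Cherednik k :=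
  RingQuot.mkAlgHom ℂ (CherednikRel k)

theorem mk_rel {x y : FreeAlgebra ℂ (HHat V ⊕ D.extWeyl)} (h : CherednikRel k x y) :
    mk k x = mk k y := RingQuot.mkAlgHom_rel ℂ h

/-- The image of `x ∈ ĥ` in `Ĥ^Y(k)`. -/
def vec : HHat V →ₗ[ℂ] Cherednik k where
  toFun x := mk k (FreeAlgebra.ι ℂ (Sum.inl x))
  map_add' x y := by rw [mk_rel k (CherednikRel.vec_add x y), map_add]
  map_smul' r x := by rw [mk_rel k (CherednikRel.vec_smul r x), map_smul, RingHom.id_apply]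

/-- The image of `w ∈ Ŵ^Y` in `Ĥ^Y(k)`. -/
def grp : D.extWeyl →* Cherednik k where
  toFun w := mk k (FreeAlgebra.ι ℂ (Sum.inr w))
  map_one' := by rw [mk_rel k CherednikRel.grp_one, map_one]
  map_mul' w w' := by rw [mk_rel k (CherednikRel.grp_mul w w'), map_mul]

end Cherednik

end AffineData

/-! ## Real analytic functions on `V̂⁺` and operators on them -/

section Analytic

variable {V : Type*} [NormedAddCommGroup V] [InnerProductSpace ℝ V]

/-- The open half space `V̂⁺ = V ⊕ ℝ c ⊕ ℝ_{>0} d`. -/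
def VPlus (V : Type*) : Set (VHat V) := {x | 0 < x.2.2}

theorem isOpen_VPlus {V : Type*} [TopologicalSpace V] : IsOpen (VPlus V) :=
  isOpen_lt continuous_const (continuous_snd.comp continuous_snd)

open Classical in
/-- Extension by zero of a function on `V̂⁺`. -/
def extZero {V : Type*} (f : VPlus V → ℂ) (x : VHat V) : ℂ :=
  if h : x ∈ VPlus V then f ⟨x, h⟩ else 0

theorem extZero_of_mem {V : Type*} (f : VPlus V → ℂ) {x : VHat V} (h : x ∈ VPlus V) :
    extZero f x = f ⟨x, h⟩ := dif_pos h

theorem analyticOnNhd_congr {F G : VHat V → ℂ} (hF : AnalyticOnNhd ℝ F (VPlus V))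
    (h : ∀ x ∈ VPlus V, F x = G x) : AnalyticOnNhd ℝ G (VPlus V) := fun x hx =>
  (hF x hx).congr (Filter.eventually_of_mem (isOpen_VPlus.mem_nhds hx) h)

variable (V) in
/-- The subspace of complex valued real analytic functions among all functions on `V̂⁺`. -/
def analyticSubmodule : Submodule ℂ (VPlus V → ℂ) where
  carrier := {f | AnalyticOnNhd ℝ (extZero f) (VPlus V)}
  add_mem' {f g} hf hg := analyticOnNhd_congr (AnalyticOnNhd.add hf hg) fun x hx => by
    simp [extZero_of_mem _ hx]
  zero_mem' := analyticOnNhd_congr (F := fun _ => 0) analyticOnNhd_const fun x hx => by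
    simp [extZero_of_mem _ hx]
  smul_mem' r f hf := analyticOnNhd_congr
    (AnalyticOnNhd.smul (f := fun _ => r) analyticOnNhd_const hf) fun x hx => by
    simp [extZero_of_mem _ hx]

variable (V) in
/-- `C^ω(V̂⁺)`: the space of complex valued real analytic functions on `V̂⁺`. -/
def COmega : Type _ := analyticSubmodule V

instance : AddCommGroup (COmega V) := inferInstanceAs (AddCommGroup (analyticSubmodule V))

instance : Module ℂ (COmega V) := inferInstanceAs (Module ℂ (analyticSubmodule V))

instance : CoeFun (COmega V) (fun _ => VPlus V → ℂ) := ⟨fun f => f.1⟩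

theorem COmega.analytic (f : COmega V) : AnalyticOnNhd ℝ (extZero f) (VPlus V) := f.2

/-- A function on `V̂⁺` whose extension by zero is analytic on `V̂⁺`, as an element of
`C^ω(V̂⁺)`. -/
def COmega.mk (f : VPlus V → ℂ) (h : AnalyticOnNhd ℝ (extZero f) (VPlus V)) : COmega V := ⟨f, h⟩

@[simp] theorem COmega.mk_apply (f : VPlus V → ℂ) (h : AnalyticOnNhd ℝ (extZero f) (VPlus V))
    (u : VPlus V) : COmega.mk f h u = f u := rfl

@[ext] theorem COmega.ext {f g : COmega V} (h : ∀ u, f u = g u) : f = g :=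
  Subtype.ext (funext h)

@[simp] theorem COmega.add_apply (f g : COmega V) (u : VPlus V) : (f + g) u = f u + g u := rfl

@[simp] theorem COmega.smul_apply (r : ℂ) (f : COmega V) (u : VPlus V) : (r • f) u = r * f u := rfl

/-- The directional derivative `(∂_v f)(u) = d/dt f(u + t v)` at `t = 0`, as an operator on
`C^ω(V̂⁺)`. -/
def dirDeriv (v : VHat V) : Module.End ℂ (COmega V) where
  toFun f := COmega.mk (fun u => deriv (fun t : ℝ => extZero f (u.1 + t • v)) 0) (by
    have h : AnalyticOnNhd ℝ (fun u => fderiv ℝ (extZero f) u v) (VPlus V) := fun u hu =>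
      ((ContinuousLinearMap.apply ℝ ℂ v).analyticAt _).fun_comp ((f.2 u hu).fderiv)
    refine analyticOnNhd_congr h fun u hu => ?_
    rw [extZero_of_mem _ hu]
    exact ((f.2 u hu).differentiableAt.lineDeriv_eq_fderiv (v := v)).symm)
  map_add' f g := by
    ext u
    have hd : ∀ f : COmega V, DifferentiableAt ℝ (fun t : ℝ => extZero f (u.1 + t • v)) 0 := by
      intro f
      refine DifferentiableAt.fun_comp' (g := extZero f) (f := fun t : ℝ => u.1 + t • v) 0 ?_
        (by fun_prop)
      simpa using (f.2 u.1 u.2).differentiableAt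
    simp only [COmega.add_apply, COmega.mk_apply]
    rw [← deriv_fun_add (hd f) (hd g)]
    congr 1
    ext t
    unfold extZero
    split_ifs <;> simp
  map_smul' r f := by
    ext u
    have hd : DifferentiableAt ℝ (fun t : ℝ => extZero f (u.1 + t • v)) 0 := by
      refine DifferentiableAt.fun_comp' (g := extZero f) (f := fun t : ℝ => u.1 + t • v) 0 ?_
        (by fun_prop)
      simpa using (f.2 u.1 u.2).differentiableAt
    simp only [COmega.smul_apply, COmega.mk_apply, RingHom.id_apply]
    rw [← deriv_const_mul r hd]
    congr 1
    ext t
    unfold extZero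
    split_ifs <;> simp

theorem sub_smul_coroot_mem {D : AffineData V} {a : VHat V} (ha : a ∈ D.affineRoots)
    {u : VHat V} (hu : u ∈ VPlus V) (t : ℝ) : u - t • coroot a ∈ VPlus V := by
  have : (u - t • coroot a).2.2 = u.2.2 := by simp [AffineData.coroot_snd_snd ha]
  exact hu.trans_eq this.symm

theorem extWeyl_snd_snd {D : AffineData V} (w : D.extWeyl) (u : VHat V) :
    ((w : VHat V ≃ₗ[ℝ] VHat V) u).2.2 = u.2.2 := by
  obtain ⟨w, hw⟩ := w
  simp only
  induction hw using Subgroup.closure_induction generalizing u with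
  | mem x hx =>
    rcases hx with ⟨α, _, rfl⟩ | ⟨y, _, rfl⟩
    · simp [refl_apply]
    · simp [transl_apply]
  | one => rfl
  | mul x y _ _ hx hy => rw [LinearEquiv.mul_apply, hx, hy]
  | inv x _ hx =>
    have := hx (x⁻¹ u)
    rw [← this, ← LinearEquiv.mul_apply, mul_inv_cancel]
    rfl

theorem extWeyl_mem_VPlus {D : AffineData V} (w : D.extWeyl) {u : VHat V} (hu : u ∈ VPlus V) :
    (w : VHat V ≃ₗ[ℝ] VHat V) u ∈ VPlus V := by
  exact hu.trans_eq (extWeyl_snd_snd w u).symm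

variable [FiniteDimensional ℝ V]

/-- The action of `Ŵ^Y` on `C^ω(V̂⁺)`: `(w f)(u) = f(w⁻¹ u)`. -/
def weylAct {D : AffineData V} (w : D.extWeyl) : Module.End ℂ (COmega V) where
  toFun f := COmega.mk (fun u => f ⟨(w⁻¹ : D.extWeyl).1 u.1, extWeyl_mem_VPlus w⁻¹ u.2⟩) (by
    have h : AnalyticOnNhd ℝ (fun u => extZero f
        (LinearMap.toContinuousLinearMap (w⁻¹ : D.extWeyl).1.toLinearMap u)) (VPlus V) :=
      fun u hu => AnalyticAt.fun_comp (g := extZero f)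
        (f.2 _ (extWeyl_mem_VPlus w⁻¹ hu)) (ContinuousLinearMap.analyticAt _ u)
    refine analyticOnNhd_congr h fun u hu => ?_
    rw [extZero_of_mem _ hu]
    exact extZero_of_mem _ (extWeyl_mem_VPlus w⁻¹ hu))
  map_add' _ _ := rfl
  map_smul' _ _ := rfl

/-- The integral-reflection operator
`(I(a) f)(u) = ∫_0^{(a, u)} f(u - t a^∨) dt` on `C^ω(V̂⁺)`, for an affine root `a`. -/
def integralReflection {D : AffineData V} (a : D.affineRoots) : Module.End ℂ (COmega V) where
  toFun f := COmega.mk (fun u => ∫ t in (0 : ℝ)..(form a.1 u.1),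
      f ⟨u.1 - t • coroot a.1, sub_smul_coroot_mem a.2 u.2 t⟩) (by
    let φ : VHat V →L[ℝ] ℝ := LinearMap.toContinuousLinearMap (form a.1)
    have hφ : ((1 / 2 : ℝ) • φ) (coroot a.1) = 1 := by
      have h := AffineData.form_self_ne_zero a.2
      change (1 / 2 : ℝ) • form a.1 (coroot a.1) = 1
      simp only [coroot, map_smul, smul_eq_mul]
      field_simp
    have h : AnalyticOnNhd ℝ (fun u => ∫ t in (0 : ℝ)..(φ u),
        extZero f (u - t • coroot a.1)) (VPlus V) := fun u hu =>
      analyticAt_lineIntegral (coroot a.1) ((1 / 2 : ℝ) • φ) hφ φ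
        (fun τ => f.2 _ (sub_smul_coroot_mem a.2 hu τ))
    refine analyticOnNhd_congr h fun u hu => ?_
    rw [extZero_of_mem _ hu]
    exact intervalIntegral.integral_congr fun t _ =>
      extZero_of_mem _ (sub_smul_coroot_mem a.2 hu t))
  map_add' f g := by
    ext u
    have hi : ∀ f : COmega V, IntervalIntegrable (fun t : ℝ =>
        f ⟨u.1 - t • coroot a.1, sub_smul_coroot_mem a.2 u.2 t⟩) MeasureTheory.volume 0
        (form a.1 u.1) := by
      intro f
      refine Continuous.intervalIntegrable ?_ _ _
      have h1 : Continuous fun t : ℝ => u.1 - t • coroot a.1 := by fun_prop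
      have h2 : Continuous fun t : ℝ => extZero f (u.1 - t • coroot a.1) :=
        f.2.continuousOn.comp_continuous h1 (sub_smul_coroot_mem a.2 u.2)
      exact h2.congr fun t => extZero_of_mem _ (sub_smul_coroot_mem a.2 u.2 t)
    exact intervalIntegral.integral_add (hi f) (hi g)
  map_smul' r f := by
    ext u
    exact intervalIntegral.integral_const_mul r _

end Analytic

end ExtCherednik

end

open ExtCherednik

open ExtCherednik

noncomputable section

/-! Uniqueness: the algebra is generated by `V̂`, the simple reflections and `Ω`. Indeed, if `w`
makes a positive affine root negative, it makes some simple `a` negative, and `w s_a` has fewer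
inversions; an element without inversions lies in `Ω`.

Existence: put `T_a = s_a ⊗ π(s_a) - k_a I(a) ⊗ id`. Calculus in the direction of `a^∨` and along
the hyperplane of `a` gives `I(a) ∂_v = ∂_{s_a v} I(a) + (a, v)`, hence the cross relation for `T_a`
(`tensorRefl_mul_tensorDeriv`). What remains is that the `T_a` and the operators of `Ω` define a
representation of the extended affine Weyl group.

The quadratic and braid relations are proved without composing integral operators. The cross
relations alone imply that the difference `E` of the two sides of such a relation satisfies `E ∂_v =
∂_{wv} E` with no lower order terms (`alternating_sub_mul`); for the braid relation of length 3 this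
uses equality of the two parameters, which follows from the invariance of `k`. On the hyperplane of
`a` the operator `I(a)` yields zero and `s_a` fixes the point, so there `T_a` acts through `π(s_a)`.
When `a` and `b` generate a finite dihedral group their hyperplanes meet in `V̂⁺`, and at a common
point `E X` vanishes because `π` is a representation. By the intertwining property all derivatives
of `E X` vanish there too, and a real analytic function on the convex set `V̂⁺` with this property
is zero (`eq_zero_of_mul_tensorDeriv`).

These relations suffice by a Matsumoto type argument (`isLift_unique`,
`exists_hom_of_liftRelations`): products of the given operators along reduced expressions depend
only on the group element, by induction on the number of inversions. If two different simple roots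
`a`, `b` are inversions of one `w`, their dihedral group is finite, since otherwise `a + b` would be
a multiple of `c`, which `w` fixes. The root combinatorics rests on the existence of the highest
root, which is derived from irreducibility. -/

namespace ExtCherednik

/-! ### Linear functionals and the monoids generated by simple roots -/

/-- Linear functionals take arbitrary prescribed values on a linearly independent set. -/
theorem exists_functional_of_linearIndependent {V : Type*} [AddCommGroup V] [Module ℝ V]
    {F : Set V} (hF : LinearIndependent ℝ (Subtype.val : F → V)) (g : V → ℝ) :
    ∃ φ : V →ₗ[ℝ] ℝ, ∀ a ∈ F, φ a = g a := by
  have hF' : LinearIndepOn ℝ id F := hF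
  let b := Module.Basis.extend hF'
  refine ⟨b.constr ℝ fun i => g i, fun a ha => ?_⟩
  have h := b.constr_basis ℝ (fun i => g i) ⟨a, hF'.subset_extend _ ha⟩
  simpa [b] using h

/-- A functional that is nonnegative on `F` is nonnegative on nonnegative combinations of `F`. -/
theorem nonneg_of_mem_closure {V : Type*} [AddCommGroup V] [Module ℝ V] {F : Set V}
    (φ : V →ₗ[ℝ] ℝ) (h : ∀ a ∈ F, 0 ≤ φ a) {x : V} (hx : x ∈ AddSubmonoid.closure F) :
    0 ≤ φ x := by
  induction hx using AddSubmonoid.closure_induction with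
  | mem x hx => exact h x hx
  | zero => simp
  | add x y _ _ hx hy => rw [map_add]; exact add_nonneg hx hy

theorem eq_zero_of_mem_closure {V : Type*} [AddCommGroup V] [Module ℝ V] {F : Set V}
    (φ : V →ₗ[ℝ] ℝ) (h : ∀ a ∈ F, φ a = 0) {x : V} (hx : x ∈ AddSubmonoid.closure F) :
    φ x = 0 := by
  induction hx using AddSubmonoid.closure_induction with
  | mem x hx => exact h x hx
  | zero => simp
  | add x y _ _ hx hy => rw [map_add, hx, hy, add_zero]

/-- If `φ = 1` on `F`, then a nonzero element of the monoid generated by `F` has `φ ≥ 1`. -/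
theorem one_le_of_mem_closure {V : Type*} [AddCommGroup V] [Module ℝ V] {F : Set V}
    (φ : V →ₗ[ℝ] ℝ) (h : ∀ a ∈ F, 1 ≤ φ a) {x : V} (hx : x ∈ AddSubmonoid.closure F)
    (hx0 : x ≠ 0) : 1 ≤ φ x := by
  have : x = 0 ∨ 1 ≤ φ x := by
    clear hx0
    induction hx using AddSubmonoid.closure_induction with
    | mem x hx => exact Or.inr (h x hx)
    | zero => exact Or.inl rfl
    | add x y _ _ hx hy =>
      rcases hx with rfl | hx
      · simpa using hy
      · rcases hy with rfl | hy
        · right; simpa using hx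
        · right; rw [map_add]; linarith
  exact this.resolve_left hx0

/-! ### Finite roots: Cartan integers, simple roots, the highest root -/

section Roots

variable {V : Type*} [NormedAddCommGroup V] [InnerProductSpace ℝ V] {R : Set V}

namespace IsIrreducibleRootSystem

theorem ne_zero (hR : IsIrreducibleRootSystem R) {α : V} (hα : α ∈ R) : α ≠ 0 :=
  fun h => hR.zero_notMem (h ▸ hα)

theorem inner_self_pos (hR : IsIrreducibleRootSystem R) {α : V} (hα : α ∈ R) :
    0 < (inner ℝ α α : ℝ) := real_inner_self_pos.2 (hR.ne_zero hα)

theorem neg_mem (hR : IsIrreducibleRootSystem R) {α : V} (hα : α ∈ R) : -α ∈ R := by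
  have h := hR.reflection_mem α hα α hα
  rw [mul_div_assoc, div_self (hR.inner_self_pos hα).ne'] at h
  convert h using 1
  module

/-- The product of the Cartan integers of two non-proportional roots is less than `4`. -/
theorem cartan_mul_lt (hR : IsIrreducibleRootSystem R) {α β : V} (hα : α ∈ R) (hβ : β ∈ R)
    (h1 : α ≠ β) (h2 : α ≠ -β) {p q : ℤ} (hp : 2 * inner ℝ β α / inner ℝ α α = (p : ℝ))
    (hq : 2 * inner ℝ α β / inner ℝ β β = (q : ℝ)) : p * q < 4 := by
  have hA := hR.inner_self_pos hα
  have hB := hR.inner_self_pos hβ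
  rw [real_inner_comm] at hp
  have hlt : (inner ℝ α β : ℝ) * inner ℝ α β < inner ℝ α α * inner ℝ β β := by
    refine lt_of_le_of_ne ?_ fun heq => ?_
    · exact (real_inner_mul_inner_self_le α β)
    · have h0 : β - ((inner ℝ α β : ℝ) / inner ℝ α α) • α = 0 := by
        rw [← inner_self_eq_zero (𝕜 := ℝ)]
        simp only [inner_sub_left, inner_sub_right, real_inner_smul_left, real_inner_smul_right,
          real_inner_comm α β]
        field_simp
        linarith
      have h3 : ((inner ℝ α β : ℝ) / inner ℝ α α) • α = β := (sub_eq_zero.1 h0).symm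
      rcases hR.reduced α hα _ (h3 ▸ hβ) with h | h
      · rw [h, one_smul] at h3; exact h1 h3
      · rw [h, neg_one_smul] at h3; exact h2 (by rw [← h3, neg_neg])
  have : (p : ℝ) * q < 4 := by
    rw [← hp, ← hq, div_mul_div_comm, div_lt_iff₀ (by positivity)]
    nlinarith
  exact_mod_cast this

/-- Both Cartan integers are positive with product less than 4, so one of them is 1, and the
corresponding reflection yields `α - β` up to sign. -/
theorem sub_mem (hR : IsIrreducibleRootSystem R) {α β : V} (hα : α ∈ R) (hβ : β ∈ R)
    (hne : α ≠ β) (hpos : 0 < (inner ℝ α β : ℝ)) : α - β ∈ R := by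
  have hA := hR.inner_self_pos hα
  have hB := hR.inner_self_pos hβ
  obtain ⟨p, hp⟩ := hR.crystallographic α hα β hβ
  obtain ⟨q, hq⟩ := hR.crystallographic β hβ α hα
  have hne' : α ≠ -β := by
    rintro rfl
    rw [inner_neg_left] at hpos
    linarith
  have hlt := hR.cartan_mul_lt hα hβ hne hne' hp hq
  have hp0 : 0 < p := by
    have : (0 : ℝ) < p := by rw [← hp, real_inner_comm]; positivity
    exact_mod_cast this
  have hq0 : 0 < q := by
    have : (0 : ℝ) < q := by rw [← hq]; positivity
    exact_mod_cast this
  have : p = 1 ∨ q = 1 := by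
    by_contra! h
    have h1 : 2 ≤ p := by omega
    have h2 : 2 ≤ q := by omega
    nlinarith
  rcases this with h | h
  · have := hR.neg_mem (hR.reflection_mem α hα β hβ)
    rw [hp, h] at this
    simpa using this
  · have := hR.reflection_mem β hβ α hα
    rw [hq, h] at this
    simpa using this

theorem add_mem (hR : IsIrreducibleRootSystem R) {α β : V} (hα : α ∈ R) (hβ : β ∈ R)
    (hne : α ≠ -β) (hneg : (inner ℝ α β : ℝ) < 0) : α + β ∈ R := by
  have := hR.sub_mem hα (hR.neg_mem hβ) hne (by rw [inner_neg_right]; linarith)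
  simpa using this

end IsIrreducibleRootSystem

namespace AffineData

variable (D : AffineData V)

theorem exists_height : ∃ h : V →ₗ[ℝ] ℝ, ∀ α ∈ D.F, h α = 1 :=
  exists_functional_of_linearIndependent D.F_linearIndependent fun _ => 1

/-- Distinct simple roots have nonpositive inner product. -/
theorem inner_simple_nonpos {α β : V} (hα : α ∈ D.F) (hβ : β ∈ D.F) (hne : α ≠ β) :
    (inner ℝ α β : ℝ) ≤ 0 := by
  classical
  by_contra! hpos
  have hm := D.isRootSystem.sub_mem (D.F_subset hα) (D.F_subset hβ) hne hpos
  -- `f` and `g` read off the coefficients of `α` and `β`. The root `α - β` has the coefficients `1`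
  -- and `-1` there, so it is neither positive nor negative.
  obtain ⟨f, hf⟩ := exists_functional_of_linearIndependent D.F_linearIndependent
    fun x => if x = α then 1 else 0
  obtain ⟨g, hg⟩ := exists_functional_of_linearIndependent D.F_linearIndependent
    fun x => if x = β then 1 else 0
  rcases D.F_base _ hm with h | h
  · have := nonneg_of_mem_closure g (fun a ha => by rw [hg a ha]; split_ifs <;> norm_num) h
    rw [map_sub, hg α hα, hg β hβ, if_neg hne, if_pos rfl] at this
    norm_num at this
  · have := nonneg_of_mem_closure f (fun a ha => by rw [hf a ha]; split_ifs <;> norm_num) h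
    rw [map_neg, map_sub, hf α hα, hf β hβ, if_neg hne.symm, if_pos rfl] at this
    norm_num at this

/-- A nonzero nonnegative combination of simple roots has positive inner product with some simple
root. -/
theorem exists_simple_inner_pos {x : V} (hx : x ∈ AddSubmonoid.closure D.F) (hx0 : x ≠ 0) :
    ∃ α ∈ D.F, 0 < (inner ℝ x α : ℝ) := by
  by_contra! h
  have := nonneg_of_mem_closure (-(innerₗ V x))
    (fun a ha => by simpa using h a ha) hx
  simp only [LinearMap.neg_apply, innerₗ_apply_apply] at this
  have := real_inner_self_pos.2 hx0
  linarith

/-- If the simple roots split into two orthogonal parts, every positive root is a combination of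
one of them. -/
theorem mem_closure_of_orthogonal {J K : Set V} (hJK : D.F = J ∪ K)
    (horth : ∀ α ∈ J, ∀ β ∈ K, (inner ℝ α β : ℝ) = 0) {β : V} (hβ : β ∈ D.R)
    (hpos : β ∈ AddSubmonoid.closure D.F) :
    β ∈ AddSubmonoid.closure J ∨ β ∈ AddSubmonoid.closure K := by
  classical
  obtain ⟨h, hh⟩ := D.exists_height
  -- Induction on a strict bound for the height; the bound 0 is contradictory because a positive
  -- root has height at least 1.
  obtain ⟨n, hn⟩ : ∃ n : ℕ, h β < n := exists_nat_gt _
  induction n generalizing β with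
  | zero =>
    have := one_le_of_mem_closure h (fun a ha => (hh a ha).ge) hpos (D.isRootSystem.ne_zero hβ)
    norm_num at hn
    linarith
  | succ n ih =>
    have hβ1 := one_le_of_mem_closure h (fun a ha => (hh a ha).ge) hpos
      (D.isRootSystem.ne_zero hβ)
    have disj : ∀ α ∈ J, α ∉ K := fun α hαJ hαK =>
      (D.isRootSystem.inner_self_pos (D.F_subset (hJK ▸ Or.inl hαJ))).ne' (horth α hαJ α hαK)
    -- Stated for arbitrary `J`, `K` so that it serves both roles of the two parts. If `α ∈ J` but
    -- `β - α` is a combination of `K`, then `β - α ⟂ α`, and `s_α β = (β - α) - α` is a root with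
    -- coefficients of both signs.
    have step : ∀ {J K : Set V}, D.F = J ∪ K →
        (∀ α ∈ J, ∀ β ∈ K, (inner ℝ α β : ℝ) = 0) → (∀ α ∈ J, α ∉ K) → ∀ α ∈ J,
        0 < (inner ℝ β α : ℝ) → β ≠ α → β - α ∈ AddSubmonoid.closure D.F →
        (β - α ∈ AddSubmonoid.closure J ∨ β - α ∈ AddSubmonoid.closure K) →
        β ∈ AddSubmonoid.closure J := by
      intro J K hJK horth disj α hα hip hne hcl hy
      have hαR : α ∈ D.R := D.F_subset (hJK ▸ Or.inl hα)
      rcases hy with hy | hy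
      · have := add_mem hy (AddSubmonoid.subset_closure hα)
        simpa using this
      · exfalso
        have hin : (inner ℝ (β - α) α : ℝ) = 0 := by
          have := eq_zero_of_mem_closure (innerₗ V α)
            (fun a ha => by simpa using horth α hα a ha) hy
          rw [real_inner_comm]; simpa using this
        have hA := D.isRootSystem.inner_self_pos hαR
        have hr := D.isRootSystem.reflection_mem α hαR β hβ
        have he : (inner ℝ β α : ℝ) = inner ℝ α α := by
          rw [inner_sub_left] at hin; linarith
        rw [he, mul_div_assoc, div_self hA.ne'] at hr
        obtain ⟨f, hf⟩ := exists_functional_of_linearIndependent D.F_linearIndependent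
          fun x => if x ∈ J then 1 else 0
        obtain ⟨g, hg⟩ := exists_functional_of_linearIndependent D.F_linearIndependent
          fun x => if x ∈ K then 1 else 0
        have hKF : ∀ a ∈ K, a ∈ D.F := fun a ha => hJK ▸ Or.inr ha
        have hfy : f (β - α) = 0 := eq_zero_of_mem_closure f (fun a ha => by
          rw [hf a (hKF a ha), if_neg fun hJ => disj a hJ ha]) hy
        have hgy : 1 ≤ g (β - α) := one_le_of_mem_closure g (fun a ha => by
          rw [hg a (hKF a ha), if_pos ha]) hy (sub_ne_zero.2 hne)
        have hfα : f α = 1 := by rw [hf α (hJK ▸ Or.inl hα), if_pos hα]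
        have hgα : g α = 0 := by rw [hg α (hJK ▸ Or.inl hα), if_neg (disj α hα)]
        rw [map_sub] at hfy hgy
        rcases D.F_base _ hr with h | h
        · have := nonneg_of_mem_closure f
            (fun a ha => by rw [hf a ha]; split_ifs <;> norm_num) h
          simp only [map_sub, map_smul, smul_eq_mul] at this
          linarith
        · have := nonneg_of_mem_closure g
            (fun a ha => by rw [hg a ha]; split_ifs <;> norm_num) h
          simp only [map_neg, map_sub, map_smul, smul_eq_mul] at this
          linarith
    obtain ⟨α, hα, hip⟩ := D.exists_simple_inner_pos hpos (D.isRootSystem.ne_zero hβ)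
    by_cases hne : β = α
    · subst hne
      rw [hJK] at hα
      exact hα.imp (fun h => AddSubmonoid.subset_closure h) fun h => AddSubmonoid.subset_closure h
    have hr := D.isRootSystem.sub_mem hβ (D.F_subset hα) hne hip
    have hcl : β - α ∈ AddSubmonoid.closure D.F := by
      -- If `β - α` were negative, its height would be at most `-1` and that of `β` at most 0.
      refine (D.F_base _ hr).resolve_right fun hneg => ?_
      have := one_le_of_mem_closure h (fun a ha => (hh a ha).ge) hneg
        (neg_ne_zero.2 (sub_ne_zero.2 hne))
      rw [map_neg, map_sub, hh α hα] at this
      linarith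
    have hlt : h (β - α) < n := by
      rw [map_sub, hh α hα]; push_cast at hn; linarith
    have hy := ih hr hcl hlt
    rw [hJK] at hα
    rcases hα with hα | hα
    · exact Or.inl (step hJK horth disj α hα hip hne hcl hy)
    · refine Or.inr (step (hJK.trans (Set.union_comm J K))
        (fun a ha b hb => by rw [real_inner_comm]; exact horth b hb a ha)
        (fun a ha hb => disj a hb ha) α hα hip hne hcl hy.symm)

/-- A root of maximal height is dominant, and irreducibility forces all its simple coefficients to
be positive. It therefore has positive inner product with every nonzero dominant nonnegative
combination of simple roots, which excludes a dominant root not below it. Existence is needed for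
`F̂` to contain `-θ + c` at all. -/
theorem exists_isHighestRoot : ∃ θ, D.IsHighestRoot θ := by
  classical
  have hR := D.isRootSystem
  obtain ⟨h, hh⟩ := D.exists_height
  have hh1 : ∀ a ∈ D.F, 1 ≤ h a := fun a ha => (hh a ha).ge
  obtain ⟨θ, hθ, hmax⟩ := Set.exists_max_image D.R h hR.finite hR.nonempty
  have hθpos : θ ∈ AddSubmonoid.closure D.F := by
    refine (D.F_base θ hθ).resolve_right fun hneg => ?_
    have h1 := one_le_of_mem_closure h hh1 hneg (neg_ne_zero.2 (hR.ne_zero hθ))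
    have h2 := hmax _ (hR.neg_mem hθ)
    rw [map_neg] at h1 h2
    linarith
  have hθ1 := one_le_of_mem_closure h hh1 hθpos (hR.ne_zero hθ)
  have hdom : ∀ α ∈ D.F, 0 ≤ (inner ℝ θ α : ℝ) := by
    intro α hα
    by_contra! hlt
    have hne : θ ≠ -α := by
      rintro rfl
      rw [map_neg, hh α hα] at hθ1
      linarith
    have := hmax _ (hR.add_mem hθ (D.F_subset hα) hne hlt)
    rw [map_add, hh α hα] at this
    linarith
  let Φ : V → V →ₗ[ℝ] ℝ := fun α => (exists_functional_of_linearIndependent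
    D.F_linearIndependent fun x => if x = α then 1 else 0).choose
  have hΦ : ∀ α, ∀ x ∈ D.F, Φ α x = if x = α then 1 else 0 := fun α =>
    (exists_functional_of_linearIndependent D.F_linearIndependent
      fun x => if x = α then 1 else 0).choose_spec
  have hΦ0 : ∀ α, ∀ x ∈ D.F, 0 ≤ Φ α x := fun α x hx => by
    rw [hΦ α x hx]; split_ifs <;> norm_num
  have hfin : D.F.Finite := hR.finite.subset D.F_subset
  have hexp : ∀ x ∈ AddSubmonoid.closure D.F, x = ∑ α ∈ hfin.toFinset, Φ α x • α := by
    intro x hx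
    induction hx using AddSubmonoid.closure_induction with
    | mem x hx =>
      rw [Finset.sum_eq_single x]
      · rw [hΦ x x hx, if_pos rfl, one_smul]
      · intro b _ hb
        rw [hΦ b x hx, if_neg hb.symm, zero_smul]
      · intro hn
        exact absurd (hfin.mem_toFinset.2 hx) hn
    | zero => simp
    | add x y _ _ hx hy =>
      conv_lhs => rw [hx, hy]
      simp only [map_add, add_smul, Finset.sum_add_distrib]
  -- `J` is the support of `θ` and `K` its complement in `F`. They turn out to be orthogonal, so `K`
  -- must be empty by irreducibility.
  have hsupp : ∀ α ∈ D.F, 0 < Φ α θ := by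
    set J : Set V := {α | α ∈ D.F ∧ 0 < Φ α θ} with hJ
    set K : Set V := {α | α ∈ D.F ∧ Φ α θ = 0} with hK
    have hJK : D.F = J ∪ K := by
      ext α
      simp only [hJ, hK, Set.mem_union, Set.mem_ofPred_eq]
      constructor
      · intro hα
        rcases (nonneg_of_mem_closure (Φ α) (hΦ0 α) hθpos).lt_or_eq with h | h
        · exact Or.inl ⟨hα, h⟩
        · exact Or.inr ⟨hα, h.symm⟩
      · rintro (h | h) <;> exact h.1
    have hneJK : ∀ α ∈ J, ∀ β ∈ K, α ≠ β := by
      rintro α hα β hβ rfl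
      exact hα.2.ne' hβ.2
    have horth : ∀ α ∈ J, ∀ β ∈ K, (inner ℝ α β : ℝ) = 0 := by
      intro α hα β hβ
      -- By dominance `(θ, β) ≥ 0`, while every term of its expansion is nonpositive since the
      -- coefficient of `β` in `θ` is 0. Hence each term vanishes.
      have h1 : (0 : ℝ) ≤ ∑ γ ∈ hfin.toFinset, Φ γ θ * inner ℝ γ β := by
        have := hdom β hβ.1
        rw [hexp θ hθpos, sum_inner] at this
        simpa only [real_inner_smul_left] using this
      have h2 : ∀ γ ∈ hfin.toFinset, Φ γ θ * inner ℝ γ β ≤ 0 := by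
        intro γ hγ
        rw [hfin.mem_toFinset] at hγ
        by_cases hγβ : γ = β
        · subst hγβ; rw [hβ.2, zero_mul]
        · exact mul_nonpos_of_nonneg_of_nonpos (nonneg_of_mem_closure (Φ γ) (hΦ0 γ) hθpos)
            (D.inner_simple_nonpos hγ hβ.1 hγβ)
      have h3 := (Finset.sum_eq_zero_iff_of_nonpos h2).1
        (le_antisymm (Finset.sum_nonpos h2) h1) α (hfin.mem_toFinset.2 hα.1)
      exact (mul_eq_zero.1 h3).resolve_left hα.2.ne'
    have hJF : ∀ α ∈ J, α ∈ D.F := fun α hα => hα.1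
    have hKF : ∀ α ∈ K, α ∈ D.F := fun α hα => hα.1
    have hcases : ∀ β ∈ D.R, (β ∈ AddSubmonoid.closure J ∨ -β ∈ AddSubmonoid.closure J) ∨
        (β ∈ AddSubmonoid.closure K ∨ -β ∈ AddSubmonoid.closure K) := by
      intro β hβ
      rcases D.F_base β hβ with h | h
      · rcases D.mem_closure_of_orthogonal hJK horth hβ h with h | h <;> simp [h]
      · rcases D.mem_closure_of_orthogonal hJK horth (hR.neg_mem hβ) h with h | h <;> simp [h]
    have horth' : ∀ x, (x ∈ AddSubmonoid.closure J ∨ -x ∈ AddSubmonoid.closure J) →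
        ∀ y, (y ∈ AddSubmonoid.closure K ∨ -y ∈ AddSubmonoid.closure K) →
        (inner ℝ x y : ℝ) = 0 := by
      have base : ∀ x ∈ AddSubmonoid.closure J, ∀ y ∈ AddSubmonoid.closure K,
          (inner ℝ x y : ℝ) = 0 := by
        intro x hx y hy
        have h1 : ∀ a ∈ J, innerₗ V a y = 0 := fun a ha =>
          eq_zero_of_mem_closure _ (fun b hb => by simpa using horth a ha b hb) hy
        have := eq_zero_of_mem_closure (innerₗ V y)
          (fun a ha => by simpa [real_inner_comm] using h1 a ha) hx
        rw [real_inner_comm]; simpa using this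
      rintro x (hx | hx) y (hy | hy)
      · exact base x hx y hy
      · simpa using base x hx _ hy
      · simpa using base _ hx y hy
      · simpa using base _ hx _ hy
    have hall := hR.irreducible
      {β | β ∈ D.R ∧ (β ∈ AddSubmonoid.closure J ∨ -β ∈ AddSubmonoid.closure J)}
      (fun β hβ => hβ.1) (by
        obtain ⟨α, hα, hne⟩ : ∃ α ∈ hfin.toFinset, Φ α θ • α ≠ 0 := by
          by_contra! h0
          exact hR.ne_zero hθ ((hexp θ hθpos).trans (Finset.sum_eq_zero h0))
        rw [hfin.mem_toFinset] at hα
        have hJα : α ∈ J := ⟨hα, lt_of_le_of_ne (nonneg_of_mem_closure (Φ α) (hΦ0 α) hθpos)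
          fun h => hne (by rw [← h, zero_smul])⟩
        exact ⟨α, D.F_subset hα, Or.inl (AddSubmonoid.subset_closure hJα)⟩)
      (fun α hα β hβ => horth' α hα.2 β ((hcases β hβ.1).resolve_left fun h => hβ.2 ⟨hβ.1, h⟩))
    intro α hα
    refine lt_of_le_of_ne (nonneg_of_mem_closure (Φ α) (hΦ0 α) hθpos) fun h0 => ?_
    have hα' : α ∈ {β | β ∈ D.R ∧ (β ∈ AddSubmonoid.closure J ∨ -β ∈ AddSubmonoid.closure J)} := by
      rw [hall]; exact D.F_subset hα
    exact (hR.inner_self_pos hα'.1).ne' (horth' α hα'.2 α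
      (Or.inl (AddSubmonoid.subset_closure ⟨hα, h0.symm⟩)))
  refine ⟨θ, hθ, ?_⟩
  by_contra! hbad
  -- Among the roots not below `θ`, one of maximal height is positive and dominant: if `(β, α) < 0`,
  -- then `β + α` is a higher root, hence below `θ`, and so is `β`.
  obtain ⟨β, ⟨hβ, hβθ⟩, hβmax⟩ := Set.exists_max_image
    {β | β ∈ D.R ∧ θ - β ∉ AddSubmonoid.closure D.F} h (hR.finite.subset fun β hβ => hβ.1) hbad
  have hβpos : β ∈ AddSubmonoid.closure D.F := by
    refine (D.F_base β hβ).resolve_right fun hneg => hβθ ?_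
    simpa [sub_eq_add_neg] using add_mem hθpos hneg
  have hβdom : ∀ α ∈ D.F, 0 ≤ (inner ℝ β α : ℝ) := by
    intro α hα
    by_contra! hlt
    have hne : β ≠ -α := by
      rintro rfl
      have := nonneg_of_mem_closure h (fun a ha => zero_le_one.trans (hh1 a ha)) hβpos
      rw [map_neg, hh α hα] at this
      linarith
    have hm := hR.add_mem hβ (D.F_subset hα) hne hlt
    have hle : θ - (β + α) ∈ AddSubmonoid.closure D.F := by
      by_contra hn
      have := hβmax _ ⟨hm, hn⟩
      rw [map_add, hh α hα] at this
      linarith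
    refine hβθ ?_
    have := add_mem hle (AddSubmonoid.subset_closure hα)
    rwa [← sub_sub, sub_add_cancel] at this
  obtain ⟨α, hα, hip⟩ := D.exists_simple_inner_pos hβpos (hR.ne_zero hβ)
  have hipθ : 0 < (inner ℝ θ β : ℝ) := by
    rw [hexp θ hθpos, sum_inner]
    refine Finset.sum_pos' (fun γ hγ => ?_) ⟨α, hfin.mem_toFinset.2 hα, ?_⟩
    · rw [hfin.mem_toFinset] at hγ
      rw [real_inner_smul_left, real_inner_comm]
      exact mul_nonneg (hsupp γ hγ).le (hβdom γ hγ)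
    · rw [real_inner_smul_left, real_inner_comm]
      exact mul_pos (hsupp α hα) hip
  have hne : θ ≠ β := fun he => hβθ (by rw [he, sub_self]; exact zero_mem _)
  -- `θ - β` is a root; it is not positive by the choice of `β` and not negative because `θ` has
  -- maximal height.
  rcases D.F_base _ (hR.sub_mem hθ hβ hne hipθ) with h1 | h1
  · exact hβθ h1
  · have h2 := one_le_of_mem_closure h hh1 h1 (neg_ne_zero.2 (sub_ne_zero.2 hne))
    have h3 := hmax β hβ
    rw [map_neg, map_sub] at h2
    linarith

end AffineData

end Roots

/-! ### Positive affine roots, inversions and the group `Ω` -/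

section Affine

variable {V : Type*} [NormedAddCommGroup V] [InnerProductSpace ℝ V]

theorem form_coroot_self {a : VHat V} (h : form a a ≠ 0) : form a (coroot a) = 2 := by
  simp only [coroot, map_smul, smul_eq_mul]; field_simp

namespace AffineData

variable (D : AffineData V)

theorem simpleAffineRoots_subset : D.simpleAffineRoots ⊆ D.affineRoots := by
  rintro _ (⟨α, hα, rfl⟩ | ⟨θ, hθ, rfl⟩)
  · exact ⟨D.F_subset hα, ⟨0, by simp⟩, rfl⟩
  · exact ⟨D.isRootSystem.neg_mem hθ.1, ⟨1, by simp⟩, rfl⟩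

theorem isHighestRoot_unique {θ θ' : V} (h : D.IsHighestRoot θ) (h' : D.IsHighestRoot θ') :
    θ = θ' := by
  obtain ⟨f, hf⟩ := D.exists_height
  by_contra hne
  have h1 := one_le_of_mem_closure f (fun a ha => (hf a ha).ge) (h.2 _ h'.1) (sub_ne_zero.2 hne)
  have h2 := nonneg_of_mem_closure f (fun a ha => (hf a ha).ge.trans' zero_le_one) (h'.2 _ h.1)
  rw [map_sub] at h1 h2
  linarith

/-- The simple affine roots are linearly independent: functionals take arbitrary values on them. -/
theorem exists_affine_functional (g : VHat V → ℝ) :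
    ∃ φ : VHat V →ₗ[ℝ] ℝ, ∀ a ∈ D.simpleAffineRoots, φ a = g a := by
  obtain ⟨θ, hθ⟩ := D.exists_isHighestRoot
  obtain ⟨f, hf⟩ := exists_functional_of_linearIndependent D.F_linearIndependent
    fun α => g (α, 0, 0)
  -- The value on `c` compensates `-f θ`, so that `-θ + c` receives the prescribed value.
  refine ⟨f ∘ₗ LinearMap.fst ℝ V (ℝ × ℝ) +
    (g (-θ, 1, 0) + f θ) • (LinearMap.fst ℝ ℝ ℝ ∘ₗ LinearMap.snd ℝ V (ℝ × ℝ)), ?_⟩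
  rintro _ (⟨α, hα, rfl⟩ | ⟨θ', hθ', rfl⟩)
  · simpa using hf α hα
  · rw [D.isHighestRoot_unique hθ' hθ]
    simp

theorem exists_affine_height :
    ∃ φ : VHat V →ₗ[ℝ] ℝ, ∀ a ∈ D.simpleAffineRoots, φ a = 1 :=
  D.exists_affine_functional fun _ => 1

/-- The nonnegative integral combinations of simple affine roots. -/
def positiveCone : AddSubmonoid (VHat V) := AddSubmonoid.closure D.simpleAffineRoots

variable {D}

theorem neg_mem_affineRoots {a : VHat V} (ha : a ∈ D.affineRoots) : -a ∈ D.affineRoots := by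
  obtain ⟨h1, ⟨m, hm⟩, h3⟩ := ha
  exact ⟨D.isRootSystem.neg_mem h1, ⟨-m, by simp [hm]⟩, by simp [h3]⟩

theorem affineRoot_ne_zero {a : VHat V} (ha : a ∈ D.affineRoots) : a ≠ 0 := by
  rintro rfl
  exact D.isRootSystem.zero_notMem ha.1

theorem simple_mem_positiveCone {a : VHat V} (ha : a ∈ D.simpleAffineRoots) :
    a ∈ D.positiveCone := AddSubmonoid.subset_closure ha

theorem finite_mem_positiveCone {x : V} (hx : x ∈ AddSubmonoid.closure D.F) :
    ((x, 0, 0) : VHat V) ∈ D.positiveCone := by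
  induction hx using AddSubmonoid.closure_induction with
  | mem x hx => exact simple_mem_positiveCone (Or.inl ⟨x, hx, rfl⟩)
  | zero => exact zero_mem _
  | add x y _ _ hx hy => simpa using add_mem hx hy

/-- Here `x + (n + 1) c = (θ + x) + (-θ + c) + n c`. The first summand is nonnegative because `-x`
is a root below `θ`, and `c = (-θ + c) + θ`. -/
theorem affine_mem_positiveCone_of_pos {x : V} (hx : x ∈ D.R) (n : ℕ) :
    ((x, (n + 1 : ℕ), 0) : VHat V) ∈ D.positiveCone := by
  obtain ⟨θ, hθ⟩ := D.exists_isHighestRoot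
  have h0 : ((-θ, 1, 0) : VHat V) ∈ D.positiveCone :=
    simple_mem_positiveCone (Or.inr ⟨θ, hθ, rfl⟩)
  have h1 := finite_mem_positiveCone (hθ.2 _ (D.isRootSystem.neg_mem hx))
  have h2 := finite_mem_positiveCone (hθ.2 _ (D.isRootSystem.neg_mem hθ.1))
  have h3 : ((θ, 0, 0) : VHat V) ∈ D.positiveCone := by
    have h4 : θ ∈ AddSubmonoid.closure D.F := by
      obtain ⟨f, hf⟩ := D.exists_height
      refine (D.F_base θ hθ.1).resolve_right fun hneg => ?_
      have h5 := one_le_of_mem_closure f (fun a ha => (hf a ha).ge) hneg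
        (neg_ne_zero.2 (D.isRootSystem.ne_zero hθ.1))
      have h6 := nonneg_of_mem_closure f (fun a ha => (hf a ha).ge.trans' zero_le_one)
        (hθ.2 _ (D.isRootSystem.neg_mem hθ.1))
      rw [map_sub, map_neg] at h6
      rw [map_neg] at h5
      linarith
    exact finite_mem_positiveCone h4
  have hc : ((0, 1, 0) : VHat V) ∈ D.positiveCone := by simpa using add_mem h0 h3
  have := add_mem (add_mem h1 h0) (nsmul_mem hc n)
  simpa [add_comm] using this

/-- The sign is that of the coefficient of `c`, and that of the finite root when this coefficient is
zero. -/
theorem pos_or_neg {a : VHat V} (ha : a ∈ D.affineRoots) :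
    a ∈ D.positiveCone ∨ -a ∈ D.positiveCone := by
  obtain ⟨x, η, ξ⟩ := a
  obtain ⟨h1, ⟨m, hm⟩, h3⟩ := ha
  simp only at h1 hm h3
  subst hm h3
  rcases lt_trichotomy m 0 with hm | rfl | hm
  · obtain ⟨n, hn⟩ : ∃ n : ℕ, -m = (n + 1 : ℕ) := ⟨(-m - 1).toNat, by omega⟩
    right
    have := affine_mem_positiveCone_of_pos (D.isRootSystem.neg_mem h1) n
    have h4 : ((n + 1 : ℕ) : ℝ) = -m := by exact_mod_cast hn.symm
    rw [h4] at this
    simpa using this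
  · rcases D.F_base _ h1 with h | h
    · left; simpa using finite_mem_positiveCone h
    · right; simpa using finite_mem_positiveCone h
  · obtain ⟨n, hn⟩ : ∃ n : ℕ, m = (n + 1 : ℕ) := ⟨(m - 1).toNat, by omega⟩
    left
    have := affine_mem_positiveCone_of_pos h1 n
    have h4 : ((n + 1 : ℕ) : ℝ) = m := by exact_mod_cast hn.symm
    rwa [h4] at this

theorem eq_zero_of_mem_of_neg_mem {x : VHat V} (h1 : x ∈ D.positiveCone)
    (h2 : -x ∈ D.positiveCone) : x = 0 := by
  by_contra hne
  obtain ⟨f, hf⟩ := D.exists_affine_height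
  have h3 := one_le_of_mem_closure f (fun a ha => (hf a ha).ge) h1 hne
  have h4 := one_le_of_mem_closure f (fun a ha => (hf a ha).ge) h2 (neg_ne_zero.2 hne)
  rw [map_neg] at h4
  linarith

/-! ### The action of the extended affine Weyl group -/

theorem form_extWeyl (w : D.extWeyl) (x y : VHat V) : form (w.1 x) (w.1 y) = form x y := by
  obtain ⟨w, hw⟩ := w
  simp only
  induction hw using Subgroup.closure_induction generalizing x y with
  | mem g hg =>
    rcases hg with ⟨α, hα, rfl⟩ | ⟨u, _, rfl⟩
    · have h := (D.isRootSystem.inner_self_pos hα).ne'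
      simp only [refl_apply, coroot, form_apply, Prod.fst_sub, Prod.snd_sub, Prod.smul_fst,
        Prod.smul_snd, smul_eq_mul, inner_sub_left, inner_sub_right, real_inner_smul_left,
        real_inner_smul_right, real_inner_comm α, mul_zero, add_zero]
      generalize (inner ℝ α α : ℝ) = c at h
      field_simp
      ring
    · simp only [transl_apply, form_apply, inner_add_left, inner_add_right, real_inner_smul_left,
        real_inner_smul_right, real_inner_comm y.1]
      ring
  | one => rfl
  | mul g g' _ _ hg hg' => rw [LinearEquiv.mul_apply, LinearEquiv.mul_apply, hg, hg']
  | inv g _ hg =>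
    have := hg (g⁻¹ x) (g⁻¹ y)
    rw [← LinearEquiv.mul_apply, ← LinearEquiv.mul_apply, mul_inv_cancel] at this
    exact this.symm

/-- Invariance of `c` makes inversion sets finite, and in `exists_braidLength` it excludes infinite
dihedral groups. -/
theorem extWeyl_c (w : D.extWeyl) (r : ℝ) : w.1 ((0, r, 0) : VHat V) = (0, r, 0) := by
  obtain ⟨w, hw⟩ := w
  simp only
  induction hw using Subgroup.closure_induction with
  | mem g hg =>
    rcases hg with ⟨α, hα, rfl⟩ | ⟨u, _, rfl⟩
    · simp [refl_apply, coroot, form_apply]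
    · simp [transl_apply]
  | one => rfl
  | mul g g' _ _ hg hg' => rw [LinearEquiv.mul_apply, hg', hg]
  | inv g _ hg =>
    conv_lhs => rw [← hg]
    rw [← LinearEquiv.mul_apply, inv_mul_cancel]
    rfl

theorem extWeyl_mem_affineRoots (w : D.extWeyl) {a : VHat V} (ha : a ∈ D.affineRoots) :
    w.1 a ∈ D.affineRoots := by
  obtain ⟨w, hw⟩ := w
  simp only
  have hgen : ∀ g ∈ ({g | ∃ α ∈ D.R, g = refl (α, 0, 0)} ∪ {g | ∃ y ∈ D.Y, g = transl y} :
      Set (VHat V ≃ₗ[ℝ] VHat V)), ∀ a ∈ D.affineRoots, g a ∈ D.affineRoots := by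
    rintro _ (⟨α, hα, rfl⟩ | ⟨y, hy, rfl⟩) ⟨β, η, ξ⟩ ⟨h1, ⟨m, hm⟩, h3⟩
    · simp only at h1 hm h3
      subst hm h3
      refine ⟨?_, ⟨m, by simp [refl_apply, coroot]⟩, by simp [refl_apply, coroot]⟩
      have := D.isRootSystem.reflection_mem α hα β h1
      convert this using 1
      simp [refl_apply, coroot, form_apply, real_inner_smul_right]
      congr 1
      ring
    · simp only at h1 hm h3
      subst hm h3
      obtain ⟨n, hn⟩ := D.Y_integral y hy β h1
      refine ⟨by simpa [transl_apply] using h1, ⟨m - n, ?_⟩, by simp [transl_apply]⟩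
      simp [transl_apply, real_inner_comm y β, hn]
  -- The inverses of the generators are again generators: reflections are involutions, and `t_y` has
  -- the inverse `t_{-y}`.
  have hinv : ∀ g ∈ ({g | ∃ α ∈ D.R, g = refl (α, 0, 0)} ∪ {g | ∃ y ∈ D.Y, g = transl y} :
      Set (VHat V ≃ₗ[ℝ] VHat V)), ∀ a ∈ D.affineRoots, g⁻¹ a ∈ D.affineRoots := by
    rintro _ (⟨α, hα, rfl⟩ | ⟨y, hy, rfl⟩) a ha
    · exact hgen _ (Or.inl ⟨α, hα, rfl⟩) a ha
    · exact hgen (transl (-y)) (Or.inr ⟨-y, neg_mem hy, rfl⟩) a ha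
  induction hw using Subgroup.closure_induction'' generalizing a with
  | mem x hx => exact hgen x hx a ha
  | inv_mem x hx => exact hinv x hx a ha
  | one => exact ha
  | mul x y _ _ hx hy => rw [LinearEquiv.mul_apply]; exact hx (hy ha)

theorem refl_extWeyl (w : D.extWeyl) (a x : VHat V) :
    refl (w.1 a) (w.1 x) = w.1 (refl a x) := by
  simp only [refl_apply, coroot, form_extWeyl, map_sub, map_smul]

theorem affRefl_apply (a : D.affineRoots) (x : VHat V) :
    (D.affRefl a).1 x = x - form x (coroot a.1) • a.1 := rfl

theorem affRefl_self (a : D.affineRoots) : (D.affRefl a).1 a.1 = -a.1 := by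
  rw [affRefl_apply, form_coroot_self (form_self_ne_zero a.2)]
  module

theorem affRefl_mul_self (a : D.affineRoots) : D.affRefl a * D.affRefl a = 1 := by
  ext1
  refine LinearEquiv.ext fun x => ?_
  exact (refl a.1).left_inv x

theorem affRefl_affRefl (a : D.affineRoots) (x : VHat V) :
    (D.affRefl a).1 ((D.affRefl a).1 x) = x := (refl a.1).left_inv x

theorem mul_affRefl (w : D.extWeyl) (a b : D.affineRoots) (h : w.1 a.1 = b.1) :
    w * D.affRefl a = D.affRefl b * w := by
  ext1
  refine LinearEquiv.ext fun x => ?_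
  change w.1 (refl a.1 x) = refl b.1 (w.1 x)
  rw [← h, refl_extWeyl]

/-- A simple reflection permutes the positive affine roots other than the simple root. -/
theorem affRefl_mem_positiveCone {a : D.affineRoots} (ha : a.1 ∈ D.simpleAffineRoots)
    {b : VHat V} (hb : b ∈ D.affineRoots) (hpos : b ∈ D.positiveCone) (hne : b ≠ a.1) :
    (D.affRefl a).1 b ∈ D.positiveCone := by
  classical
  refine (pos_or_neg (extWeyl_mem_affineRoots _ hb)).resolve_right fun hneg => hne ?_
  obtain ⟨h, hh⟩ := D.exists_affine_height
  have hspan : ∀ x ∈ D.positiveCone, ∀ f : VHat V →ₗ[ℝ] ℝ,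
      (∀ c ∈ D.simpleAffineRoots, f c = if c = a.1 then 0 else 1) → f x = 0 →
      x ∈ Submodule.span ℝ {a.1} := by
    intro x hx f hf
    have hf0 : ∀ c ∈ D.simpleAffineRoots, 0 ≤ f c := fun c hc => by
      rw [hf c hc]; split_ifs <;> norm_num
    induction hx using AddSubmonoid.closure_induction with
    | mem c hc =>
      intro h0
      by_cases hca : c = a.1
      · rw [hca]; exact Submodule.mem_span_singleton_self _
      · rw [hf c hc, if_neg hca] at h0
        norm_num at h0
    | zero => exact fun _ => zero_mem _
    | add x y hx hy ihx ihy =>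
      intro h0
      have h1 := nonneg_of_mem_closure f hf0 hx
      have h2 := nonneg_of_mem_closure f hf0 hy
      rw [map_add] at h0
      exact add_mem (ihx (by linarith)) (ihy (by linarith))
  -- `f` sums the coefficients at the simple roots other than `a`, so `s_a` does not change its
  -- value. If `b` is positive and `s_a b` negative, then `f b = 0`; so `b` is a multiple of `a`,
  -- and equals `a` since `R` is reduced and `b` is positive.
  obtain ⟨f, hf⟩ := D.exists_affine_functional fun c => if c = a.1 then 0 else 1
  have hf0 : ∀ c ∈ D.simpleAffineRoots, 0 ≤ f c := fun c hc => by
    rw [hf c hc]; split_ifs <;> norm_num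
  have h1 := nonneg_of_mem_closure f hf0 hpos
  have h2 := nonneg_of_mem_closure f hf0 hneg
  have hfa : f a.1 = 0 := by rw [hf _ ha, if_pos rfl]
  rw [affRefl_apply, map_neg, map_sub, map_smul, hfa, smul_zero, sub_zero] at h2
  obtain ⟨r, hr⟩ := Submodule.mem_span_singleton.1 (hspan b hpos f hf (by linarith))
  have hrR : r • a.1.1 ∈ D.R := by rw [← Prod.smul_fst, hr]; exact hb.1
  have hhb := nonneg_of_mem_closure h (fun c hc => (hh c hc).ge.trans' zero_le_one) hpos
  rcases D.isRootSystem.reduced _ a.2.1 r hrR with h3 | h3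
  · rw [← hr, h3, one_smul]
  · rw [← hr, h3, map_smul, hh _ ha] at hhb
    norm_num at hhb

/-! ### Inversions -/

/-- The positive affine roots that `w` makes negative. -/
def inversions (w : D.extWeyl) : Set (VHat V) :=
  {a | a ∈ D.affineRoots ∧ a ∈ D.positiveCone ∧ -w.1 a ∈ D.positiveCone}

/-- Since `w` fixes `c`, a root `β + m c` is an inversion only if `m ≥ 0` and the coefficient of `c`
in `w β`, increased by `m`, is nonpositive. This leaves finitely many `m` for each of the finitely
many `β`. -/
theorem inversions_finite (w : D.extWeyl) : (inversions w).Finite := by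
  refine (D.isRootSystem.finite.biUnion (t := fun β => (fun m : ℤ => ((β, (m : ℝ), 0) : VHat V)) ''
    Set.Icc 0 ⌊-(w.1 ((β, 0, 0) : VHat V)).2.1⌋)
    fun β _ => (Set.finite_Icc _ _).image _).subset ?_
  rintro ⟨β, η, ξ⟩ ⟨⟨h1, ⟨m, hm⟩, h3⟩, hpos, hneg⟩
  simp only at h1 hm h3
  subst hm h3
  have hc : ∀ x ∈ D.positiveCone, 0 ≤ x.2.1 := by
    intro x hx
    refine nonneg_of_mem_closure
      (LinearMap.fst ℝ ℝ ℝ ∘ₗ LinearMap.snd ℝ V (ℝ × ℝ)) ?_ hx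
    rintro _ (⟨α, hα, rfl⟩ | ⟨θ, hθ, rfl⟩) <;> simp
  refine Set.mem_biUnion h1 ⟨m, ⟨?_, Int.le_floor.2 ?_⟩, rfl⟩
  · have := hc _ hpos
    simpa using this
  · have h4 := hc _ hneg
    have h5 : ((β, (m : ℝ), 0) : VHat V) = (β, 0, 0) + (0, (m : ℝ), 0) := by simp
    rw [h5, map_add, extWeyl_c] at h4
    simp at h4
    linarith

theorem mem_Omega_of_inversions_eq_empty {w : D.extWeyl} (h : inversions w = ∅) : w ∈ D.Omega := by
  rintro a ⟨ha, hpos⟩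
  refine ⟨extWeyl_mem_affineRoots w ha, (pos_or_neg (extWeyl_mem_affineRoots w ha)).resolve_right
    fun hneg => ?_⟩
  exact Set.eq_empty_iff_forall_notMem.1 h a ⟨ha, hpos, hneg⟩

theorem map_positiveCone (w : D.extWeyl) (h : ∀ a ∈ D.simpleAffineRoots, w.1 a ∈ D.positiveCone)
    {x : VHat V} (hx : x ∈ D.positiveCone) : w.1 x ∈ D.positiveCone := by
  induction hx using AddSubmonoid.closure_induction with
  | mem a ha => exact h a ha
  | zero => rw [map_zero]; exact zero_mem _
  | add x y _ _ hx hy => rw [map_add]; exact add_mem hx hy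

/-- If all simple roots stayed positive, so would all their nonnegative combinations. -/
theorem exists_simple_mem_inversions {w : D.extWeyl} (h : (inversions w).Nonempty) :
    ∃ a : D.affineRoots, a.1 ∈ D.simpleAffineRoots ∧ -w.1 a.1 ∈ D.positiveCone := by
  by_contra! hno
  obtain ⟨b, hb, hpos, hneg⟩ := h
  have h1 : w.1 b ∈ D.positiveCone := map_positiveCone w (fun a ha =>
    (pos_or_neg (extWeyl_mem_affineRoots w (D.simpleAffineRoots_subset ha))).resolve_right
      (hno ⟨a, D.simpleAffineRoots_subset ha⟩ ha)) hpos
  exact affineRoot_ne_zero (extWeyl_mem_affineRoots w hb) (eq_zero_of_mem_of_neg_mem h1 hneg)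

/-- The number of inversions serves as the length. The reflection `s_a` permutes the positive roots
other than `a`, so it embeds the inversions of `w s_a` into those of `w`, missing `a`. -/
theorem ncard_inversions_mul_lt {w : D.extWeyl} {a : D.affineRoots}
    (ha : a.1 ∈ D.simpleAffineRoots) (hneg : -w.1 a.1 ∈ D.positiveCone) :
    (inversions (w * D.affRefl a)).ncard < (inversions w).ncard := by
  have hane : ∀ b ∈ inversions (w * D.affRefl a), b ≠ a.1 := by
    rintro _ ⟨hb, hpos, hn⟩ rfl
    rw [Subgroup.coe_mul, LinearEquiv.mul_apply, affRefl_self, map_neg, neg_neg] at hn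
    exact affineRoot_ne_zero (extWeyl_mem_affineRoots w hb) (eq_zero_of_mem_of_neg_mem hn hneg)
  have hsub : (D.affRefl a).1 '' inversions (w * D.affRefl a) ⊆ inversions w \ {a.1} := by
    rintro _ ⟨b, hb, rfl⟩
    refine ⟨⟨extWeyl_mem_affineRoots _ hb.1, affRefl_mem_positiveCone ha hb.1 hb.2.1 (hane b hb),
      hb.2.2⟩, fun h => ?_⟩
    have h1 : b = -a.1 := by
      rw [← affRefl_affRefl a b, Set.mem_singleton_iff.1 h, affRefl_self]
    refine affineRoot_ne_zero hb.1 (eq_zero_of_mem_of_neg_mem hb.2.1 ?_)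
    rw [h1, neg_neg]
    exact simple_mem_positiveCone ha
  have hamem : a.1 ∈ inversions w := ⟨a.2, simple_mem_positiveCone ha, hneg⟩
  calc _ = ((D.affRefl a).1 '' inversions (w * D.affRefl a)).ncard :=
        (Set.ncard_image_of_injective _ (D.affRefl a).1.injective).symm
    _ ≤ (inversions w \ {a.1}).ncard := Set.ncard_le_ncard hsub ((inversions_finite w).sdiff)
    _ < _ := Set.ncard_sdiff_singleton_lt_of_mem hamem (inversions_finite w)

/-! ### The group `Ω` -/

theorem Omega_apply_mem {w : D.extWeyl} (hw : w ∈ D.Omega) {a : VHat V}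
    (ha : a ∈ D.simpleAffineRoots) : w.1 a ∈ D.positiveCone :=
  (hw a ⟨D.simpleAffineRoots_subset ha, AddSubmonoid.subset_closure ha⟩).2

theorem Omega_inv {w : D.extWeyl} (hw : w ∈ D.Omega) : w⁻¹ ∈ D.Omega := by
  rintro a ⟨ha, hpos⟩
  have hm := extWeyl_mem_affineRoots w⁻¹ ha
  refine ⟨hm, (pos_or_neg hm).resolve_right fun hneg => ?_⟩
  have h1 := (hw _ ⟨neg_mem_affineRoots hm, hneg⟩).2
  rw [map_neg, ← LinearEquiv.mul_apply, ← Subgroup.coe_mul, mul_inv_cancel] at h1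
  exact affineRoot_ne_zero ha (eq_zero_of_mem_of_neg_mem hpos h1)

/-- `Ω` permutes the simple affine roots. -/
theorem Omega_apply_simple {w : D.extWeyl} (hw : w ∈ D.Omega) {a : VHat V}
    (ha : a ∈ D.simpleAffineRoots) : w.1 a ∈ D.simpleAffineRoots := by
  obtain ⟨h, hh⟩ := D.exists_affine_height
  -- Simple roots are the indecomposable elements of the cone. A decomposition of `w a` would be
  -- carried by `w⁻¹ ∈ Ω` to one of `a`, whose height 1 is too small for two nonzero summands.
  have hsplit : ∀ x ∈ D.positiveCone, x = 0 ∨ x ∈ D.simpleAffineRoots ∨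
      ∃ y ∈ D.positiveCone, ∃ z ∈ D.positiveCone, y ≠ 0 ∧ z ≠ 0 ∧ x = y + z := by
    intro x hx
    induction hx using AddSubmonoid.closure_induction with
    | mem x hx => exact Or.inr (Or.inl hx)
    | zero => exact Or.inl rfl
    | add x y hx hy ihx ihy =>
      by_cases hx0 : x = 0
      · simpa [hx0] using ihy
      by_cases hy0 : y = 0
      · simpa [hy0] using ihx
      exact Or.inr (Or.inr ⟨x, hx, y, hy, hx0, hy0, rfl⟩)
  have hne := affineRoot_ne_zero (extWeyl_mem_affineRoots w (D.simpleAffineRoots_subset ha))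
  rcases hsplit _ (Omega_apply_mem hw ha) with h0 | h0 | ⟨y, hy, z, hz, hy0, hz0, hyz⟩
  · exact absurd h0 hne
  · exact h0
  · exfalso
    have hinv := fun x (hx : x ∈ D.positiveCone) => map_positiveCone w⁻¹
      (fun a ha => Omega_apply_mem (Omega_inv hw) ha) hx
    have hinj : ∀ x, x ≠ 0 → (w⁻¹).1 x ≠ 0 := fun x hx =>
      (LinearEquiv.map_ne_zero_iff _).2 hx
    have h1 := one_le_of_mem_closure h (fun a ha => (hh a ha).ge) (hinv y hy) (hinj y hy0)
    have h2 := one_le_of_mem_closure h (fun a ha => (hh a ha).ge) (hinv z hz) (hinj z hz0)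
    have h3 : a = (w⁻¹).1 y + (w⁻¹).1 z := by
      rw [← map_add, ← hyz, ← LinearEquiv.mul_apply, ← Subgroup.coe_mul, inv_mul_cancel]
      rfl
    have h4 := hh a ha
    rw [h3, map_add] at h4
    linarith

end AffineData

end Affine

/-! ### Braid relations and rank two combinatorics -/

/-- The alternating product `x y x ⋯` with `n` factors. -/
def alternating {A : Type*} [Monoid A] (x y : A) : ℕ → A
  | 0 => 1
  | n + 1 => x * alternating y x n

/-- The reversed word is a right inverse. This permits cancellation in `isLift_unique`, where the
target is only a monoid. -/
theorem alternating_mul_reverse {A : Type*} [Monoid A] (n : ℕ) :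
    ∀ x y : A, x * x = 1 → y * y = 1 → ∃ z, alternating x y n * z = 1 := by
  induction n with
  | zero => exact fun _ _ _ _ => ⟨1, one_mul 1⟩
  | succ n ih =>
    intro x y hx hy
    obtain ⟨z, hz⟩ := ih y x hy hx
    exact ⟨z * x, by rw [alternating, mul_assoc, ← mul_assoc _ z, hz, one_mul, hx]⟩

/-- The lengths of the braid relations for crystallographic reflections with Cartan integers `p`
and `q`. -/
def IsBraidLength (m : ℕ) (p q : ℤ) : Prop :=
  (m = 2 ∧ p = 0 ∧ q = 0) ∨ (m = 3 ∧ p = -1 ∧ q = -1) ∨ (m = 4 ∧ p = -1 ∧ q = -2) ∨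
    (m = 4 ∧ p = -2 ∧ q = -1) ∨ (m = 6 ∧ p = -1 ∧ q = -3) ∨ (m = 6 ∧ p = -3 ∧ q = -1)

theorem IsBraidLength.symm {m : ℕ} {p q : ℤ} (h : IsBraidLength m p q) : IsBraidLength m q p := by
  unfold IsBraidLength at *
  tauto

theorem exists_isBraidLength {p q : ℤ} (hp : p ≤ 0) (hq : q ≤ 0) (h : p * q < 4)
    (h0 : p = 0 ↔ q = 0) : ∃ m, IsBraidLength m p q := by
  by_cases hp0 : p = 0
  · exact ⟨2, Or.inl ⟨rfl, hp0, h0.1 hp0⟩⟩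
  have hq0 : q ≠ 0 := fun hq0 => hp0 (h0.2 hq0)
  have hp1 : p ≤ -1 := by omega
  have hq1 : q ≤ -1 := by omega
  have hp3 : -3 ≤ p := by nlinarith
  have hq3 : -3 ≤ q := by nlinarith
  unfold IsBraidLength
  interval_cases p <;> interval_cases q <;> first | omega | simp

namespace AffineData

variable {V : Type*} [NormedAddCommGroup V] [InnerProductSpace ℝ V] {D : AffineData V}

/-- The point is that `-θ` is not a simple root: `θ` would have height `-1` and could not dominate
the root `-θ`. -/
theorem simple_fst_injective {a b : VHat V} (ha : a ∈ D.simpleAffineRoots)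
    (hb : b ∈ D.simpleAffineRoots) (h : a.1 = b.1) : a = b := by
  have key : ∀ α ∈ D.F, ∀ θ, D.IsHighestRoot θ → α ≠ -θ := by
    rintro α hα θ hθ rfl
    obtain ⟨f, hf⟩ := D.exists_height
    have h1 := nonneg_of_mem_closure f (fun a ha => (hf a ha).ge.trans' zero_le_one)
      (hθ.2 _ (D.F_subset hα))
    have h2 := hf _ hα
    rw [map_sub] at h1
    rw [map_neg] at h1 h2
    linarith
  rcases ha with ⟨α, hα, rfl⟩ | ⟨θ, hθ, rfl⟩ <;> rcases hb with ⟨β, hβ, rfl⟩ | ⟨θ', hθ', rfl⟩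
  · exact congrArg (fun x => (x, 0, 0)) h
  · exact absurd h (key α hα θ' hθ')
  · exact absurd h.symm (key β hβ θ hθ)
  · rw [D.isHighestRoot_unique hθ hθ']

theorem form_coroot_eq {a b : VHat V} (ha : a ∈ D.affineRoots) (hb : b ∈ D.affineRoots) :
    form a (coroot b) = 2 * inner ℝ a.1 b.1 / inner ℝ b.1 b.1 := by
  simp only [coroot, map_smul, smul_eq_mul, form_apply, ha.2.2, hb.2.2]
  ring

theorem inner_simple_affine_nonpos {a b : VHat V} (ha : a ∈ D.simpleAffineRoots)
    (hb : b ∈ D.simpleAffineRoots) (hne : a ≠ b) : (inner ℝ a.1 b.1 : ℝ) ≤ 0 := by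
  classical
  by_contra! hpos
  have ha' := D.simpleAffineRoots_subset ha
  have hb' := D.simpleAffineRoots_subset hb
  have hm : a - b ∈ D.affineRoots := by
    refine ⟨D.isRootSystem.sub_mem ha'.1 hb'.1 (fun h => hne (simple_fst_injective ha hb h)) hpos,
      ?_, by simp [ha'.2.2, hb'.2.2]⟩
    obtain ⟨m, hm⟩ := ha'.2.1
    obtain ⟨n, hn⟩ := hb'.2.1
    exact ⟨m - n, by simp [hm, hn]⟩
  obtain ⟨f, hf⟩ := D.exists_affine_functional fun x => if x = a then 1 else 0
  obtain ⟨g, hg⟩ := D.exists_affine_functional fun x => if x = b then 1 else 0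
  rcases pos_or_neg hm with h | h
  · have := nonneg_of_mem_closure g (fun c hc => by rw [hg c hc]; split_ifs <;> norm_num) h
    rw [map_sub, hg a ha, hg b hb, if_neg hne, if_pos rfl] at this
    norm_num at this
  · have := nonneg_of_mem_closure f (fun c hc => by rw [hf c hc]; split_ifs <;> norm_num) h
    rw [map_neg, map_sub, hf a ha, hf b hb, if_neg hne.symm, if_pos rfl] at this
    norm_num at this

/-- The Cartan integers are nonpositive with product less than 4 unless the finite parts of `a` and
`b` are opposite. That exceptional case, an infinite dihedral group, is incompatible with an element
`w` making both roots negative. -/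
theorem exists_braidLength {a b : VHat V} (ha : a ∈ D.simpleAffineRoots)
    (hb : b ∈ D.simpleAffineRoots) (hne : a ≠ b) {w : D.extWeyl}
    (hwa : -w.1 a ∈ D.positiveCone) (hwb : -w.1 b ∈ D.positiveCone) :
    ∃ m p q, IsBraidLength m p q ∧ form a (coroot b) = (p : ℝ) ∧ form b (coroot a) = (q : ℝ) := by
  have ha' := D.simpleAffineRoots_subset ha
  have hb' := D.simpleAffineRoots_subset hb
  have hR := D.isRootSystem
  have hA := hR.inner_self_pos ha'.1
  have hB := hR.inner_self_pos hb'.1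
  have hip := inner_simple_affine_nonpos ha hb hne
  obtain ⟨p, hp⟩ := hR.crystallographic _ hb'.1 _ ha'.1
  obtain ⟨q, hq⟩ := hR.crystallographic _ ha'.1 _ hb'.1
  -- Otherwise `a + b` is a multiple of `c`, hence fixed by `w`; it would be positive and negative
  -- at once, thus zero, although its height is 2.
  have hneg : b.1 ≠ -a.1 := by
    intro h
    have h1 : a + b = (0, (a + b).2.1, 0) := by
      ext
      · simp [h]
      · rfl
      · simp [ha'.2.2, hb'.2.2]
    have h2 : w.1 (a + b) = a + b := by
      conv_lhs => rw [h1, extWeyl_c]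
      exact h1.symm
    have h3 := add_mem hwa hwb
    rw [← neg_add, ← map_add, h2] at h3
    have h4 := eq_zero_of_mem_of_neg_mem
      (add_mem (simple_mem_positiveCone ha) (simple_mem_positiveCone hb)) h3
    obtain ⟨f, hf⟩ := D.exists_affine_height
    have h5 : f (a + b) = 0 := by rw [h4, map_zero]
    rw [map_add, hf a ha, hf b hb] at h5
    norm_num at h5
  have hlt := hR.cartan_mul_lt hb'.1 ha'.1
    (fun h => hne (simple_fst_injective hb ha h).symm) hneg hp hq
  have hp0 : p ≤ 0 := by
    have : (p : ℝ) ≤ 0 := by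
      rw [← hp]; exact div_nonpos_of_nonpos_of_nonneg (by linarith) hB.le
    exact_mod_cast this
  have hq0 : q ≤ 0 := by
    have : (q : ℝ) ≤ 0 := by
      rw [← hq, real_inner_comm]; exact div_nonpos_of_nonpos_of_nonneg (by linarith) hA.le
    exact_mod_cast this
  have hiff : p = 0 ↔ q = 0 := by
    have h1 : p = 0 ↔ (inner ℝ a.1 b.1 : ℝ) = 0 := by
      rw [← Int.cast_eq_zero (α := ℝ), ← hp, div_eq_zero_iff]
      simp [hR.ne_zero hb'.1]
    have h2 : q = 0 ↔ (inner ℝ a.1 b.1 : ℝ) = 0 := by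
      rw [← Int.cast_eq_zero (α := ℝ), ← hq, div_eq_zero_iff, real_inner_comm]
      simp [hR.ne_zero ha'.1]
    rw [h1, h2]
  obtain ⟨m, hm⟩ := exists_isBraidLength hp0 hq0 hlt hiff
  exact ⟨m, p, q, hm, (form_coroot_eq ha' hb').trans hp, (form_coroot_eq hb' ha').trans hq⟩

/-- The braid relations for reflections. -/
theorem alternating_affRefl {a b : D.affineRoots} {m : ℕ} {p q : ℤ} (hm : IsBraidLength m p q)
    (hp : form a.1 (coroot b.1) = (p : ℝ)) (hq : form b.1 (coroot a.1) = (q : ℝ)) :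
    alternating (D.affRefl a) (D.affRefl b) m = alternating (D.affRefl b) (D.affRefl a) m := by
  have ha2 := form_coroot_self (form_self_ne_zero a.2)
  have hb2 := form_coroot_self (form_self_ne_zero b.2)
  ext1
  refine LinearEquiv.ext fun x => ?_
  rcases hm with ⟨rfl, rfl, rfl⟩ | ⟨rfl, rfl, rfl⟩ | ⟨rfl, rfl, rfl⟩ | ⟨rfl, rfl, rfl⟩ |
    ⟨rfl, rfl, rfl⟩ | ⟨rfl, rfl, rfl⟩ <;>
  · simp only [alternating, mul_one, Subgroup.coe_mul, LinearEquiv.mul_apply, affRefl_apply,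
      map_sub, map_smul, ha2, hb2, hp, hq]
    push_cast
    module

/-- A sequence of `n` conditions of negativity along an alternating product, for the images `x`
and `y` of two simple roots with Cartan integers `p` and `q`. -/
def NegativeAlong (D : AffineData V) : ℕ → ℤ → ℤ → VHat V → VHat V → Prop
  | 0, _, _, _, _ => True
  | n + 1, p, q, x, y => -x ∈ D.positiveCone ∧ NegativeAlong D n q p (y - q • x) (-x)

/-- If `x = w a` and `y = w b`, passing from `w` to `w s_a` and exchanging the roles of the roots
replaces `(x, y)` by `(y - q x, -x)`. The successive first entries are the images of the `m`
positive roots of the rank two system; the pairs of numbers below are their coefficients in `x` and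
`y`. So every letter of the alternating word removes inversions. -/
theorem negativeAlong {m : ℕ} {p q : ℤ} (hm : IsBraidLength m p q) {x y : VHat V}
    (hx : -x ∈ D.positiveCone) (hy : -y ∈ D.positiveCone) : NegativeAlong D m p q x y := by
  have key : ∀ (z : VHat V) (i j : ℕ), z = i • x + j • y → -z ∈ D.positiveCone := by
    rintro _ i j rfl
    have := add_mem (nsmul_mem hx i) (nsmul_mem hy j)
    convert this using 1
    module
  rcases hm with ⟨rfl, rfl, rfl⟩ | ⟨rfl, rfl, rfl⟩ | ⟨rfl, rfl, rfl⟩ | ⟨rfl, rfl, rfl⟩ |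
    ⟨rfl, rfl, rfl⟩ | ⟨rfl, rfl, rfl⟩
  · exact ⟨hx, key _ 0 1 (by module), trivial⟩
  · exact ⟨hx, key _ 1 1 (by module), key _ 0 1 (by module), trivial⟩
  · exact ⟨hx, key _ 2 1 (by module), key _ 1 1 (by module), key _ 0 1 (by module), trivial⟩
  · exact ⟨hx, key _ 1 1 (by module), key _ 1 2 (by module), key _ 0 1 (by module), trivial⟩
  · exact ⟨hx, key _ 3 1 (by module), key _ 2 1 (by module), key _ 3 2 (by module),
      key _ 1 1 (by module), key _ 0 1 (by module), trivial⟩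
  · exact ⟨hx, key _ 1 1 (by module), key _ 2 3 (by module), key _ 1 2 (by module),
      key _ 1 3 (by module), key _ 0 1 (by module), trivial⟩

/-! ### A presentation of the extended affine Weyl group, by a Matsumoto type argument -/

section Lift

variable {A : Type*} [Monoid A] (τ : D.extWeyl → A) (T : D.affineRoots → A)

/-- `X` is a product of the values of `T` and `τ` along a reduced expression of `w`. -/
inductive IsLift : D.extWeyl → A → Prop
  | omega (w : D.extWeyl) (hw : w ∈ D.Omega) : IsLift w (τ w)
  | step (w : D.extWeyl) (X : A) (a : D.affineRoots) (ha : a.1 ∈ D.simpleAffineRoots)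
      (hneg : -w.1 a.1 ∈ D.positiveCone) (h : IsLift (w * D.affRefl a) X) : IsLift w (X * T a)

/-- The relations that make `T` and `τ` extend to the extended affine Weyl group. -/
structure LiftRelations : Prop where
  map_one : τ 1 = 1
  map_mul : ∀ w w', τ (w * w') = τ w * τ w'
  involutive : ∀ a : D.affineRoots, a.1 ∈ D.simpleAffineRoots → T a * T a = 1
  conj : ∀ w ∈ D.Omega, ∀ a b : D.affineRoots, a.1 ∈ D.simpleAffineRoots →
    w.1 a.1 = b.1 → τ w * T a = T b * τ w
  braid : ∀ a b : D.affineRoots, a.1 ∈ D.simpleAffineRoots → b.1 ∈ D.simpleAffineRoots →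
    ∀ m p q, IsBraidLength m p q → form a.1 (coroot b.1) = (p : ℝ) →
    form b.1 (coroot a.1) = (q : ℝ) → alternating (T a) (T b) m = alternating (T b) (T a) m

/-- Descent on the number of inversions: strip off simple reflections until an element of `Ω`
remains. No relations between the values are needed. -/
theorem exists_isLift (w : D.extWeyl) : ∃ X, IsLift τ T w X := by
  obtain ⟨n, hn⟩ : ∃ n, (inversions w).ncard = n := ⟨_, rfl⟩
  induction n using Nat.strong_induction_on generalizing w with
  | _ n ih =>
    rcases (inversions w).eq_empty_or_nonempty with h | h
    · exact ⟨_, IsLift.omega w (mem_Omega_of_inversions_eq_empty h)⟩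
    · obtain ⟨a, ha, hneg⟩ := exists_simple_mem_inversions h
      obtain ⟨X, hX⟩ := ih _ (hn ▸ ncard_inversions_mul_lt ha hneg) (w * D.affRefl a) rfl
      exact ⟨_, IsLift.step w X a ha hneg hX⟩

theorem not_neg_of_mem_Omega {w : D.extWeyl} (hw : w ∈ D.Omega) {a : D.affineRoots}
    (ha : a.1 ∈ D.simpleAffineRoots) (hneg : -w.1 a.1 ∈ D.positiveCone) : False :=
  affineRoot_ne_zero (extWeyl_mem_affineRoots w a.2)
    (eq_zero_of_mem_of_neg_mem (Omega_apply_mem hw ha) hneg)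

variable {τ T}

/-- Descending from `w` to `w s_a`, a lift `Z` of `w s_a` gives the lift `Z T_a` of `w`. Uniqueness
below `N` identifies it with `X`, and `T_a² = 1` then gives `X T_a = Z`. -/
theorem isLift_alternating (hT : LiftRelations τ T) (N : ℕ)
    (hU : ∀ w : D.extWeyl, (inversions w).ncard < N → ∀ X Y, IsLift τ T w X → IsLift τ T w Y →
      X = Y) (n : ℕ) : ∀ (w : D.extWeyl) (a b : D.affineRoots) (p q : ℤ) (X : A),
      (inversions w).ncard < N → IsLift τ T w X →
      a.1 ∈ D.simpleAffineRoots → b.1 ∈ D.simpleAffineRoots →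
      form a.1 (coroot b.1) = (p : ℝ) → form b.1 (coroot a.1) = (q : ℝ) →
      NegativeAlong D n p q (w.1 a.1) (w.1 b.1) →
      IsLift τ T (w * alternating (D.affRefl a) (D.affRefl b) n)
        (X * alternating (T a) (T b) n) ∧
      (inversions (w * alternating (D.affRefl a) (D.affRefl b) n)).ncard < N := by
  induction n with
  | zero =>
    intro w a b p q X hw hX _ _ _ _ _
    simpa [alternating] using ⟨hX, hw⟩
  | succ n ih =>
    rintro w a b p q X hw hX ha hb hp hq ⟨hneg, hn⟩
    obtain ⟨Z, hZ⟩ := exists_isLift τ T (w * D.affRefl a)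
    have h1 : Z * T a = X := hU w hw _ _ (IsLift.step w Z a ha hneg hZ) hX
    have h2 : X * T a = Z := by rw [← h1, mul_assoc, hT.involutive a ha, mul_one]
    simp only [alternating, ← mul_assoc, h2]
    refine ih _ b a q p Z ((ncard_inversions_mul_lt ha hneg).trans hw) hZ hb ha hq hp ?_
    rw [Subgroup.coe_mul, LinearEquiv.mul_apply, LinearEquiv.mul_apply, affRefl_self,
      affRefl_apply, hq, map_sub, map_smul, map_neg, Int.cast_smul_eq_zsmul]
    exact hn

/-- Suppose that two reduced expressions end in different letters `a` and `b`. Multiplying by the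
two alternating words of length `m` leads from `w` to one and the same element with fewer
inversions, where the lifts agree by induction. The braid relation in `A` makes the two right
factors equal, and they can be cancelled. -/
theorem isLift_unique (hT : LiftRelations τ T) {w : D.extWeyl} {X Y : A} (hX : IsLift τ T w X)
    (hY : IsLift τ T w Y) : X = Y := by
  obtain ⟨N, hN⟩ : ∃ n, (inversions w).ncard = n := ⟨_, rfl⟩
  induction N using Nat.strong_induction_on generalizing w X Y with
  | _ N ih =>
    have hU : ∀ w : D.extWeyl, (inversions w).ncard < N → ∀ X Y, IsLift τ T w X →
        IsLift τ T w Y → X = Y := fun w hw X Y hX hY => ih _ hw hX hY rfl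
    cases hX with
    | omega _ hw =>
      cases hY with
      | omega => rfl
      | step _ Y b hb hnb hY => exact (not_neg_of_mem_Omega hw hb hnb).elim
    | step _ X a ha hna hX =>
      cases hY with
      | omega _ hw => exact (not_neg_of_mem_Omega hw ha hna).elim
      | step _ Y b hb hnb hY =>
        by_cases hab : a = b
        · subst hab
          rw [hU _ (hN ▸ ncard_inversions_mul_lt ha hna) _ _ hX hY]
        obtain ⟨m, p, q, hm, hp, hq⟩ := exists_braidLength ha hb
          (fun h => hab (Subtype.ext h)) hna hnb
        -- The first letter of the alternating word cancels the final `T a`; the remaining word,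
        -- with one letter less, starts with `b` and is applied to the shorter element `w s_a`.
        have key : ∀ (a b : D.affineRoots) (X : A) (p q : ℤ), IsBraidLength m p q →
            a.1 ∈ D.simpleAffineRoots → b.1 ∈ D.simpleAffineRoots →
            form a.1 (coroot b.1) = (p : ℝ) → form b.1 (coroot a.1) = (q : ℝ) →
            -w.1 a.1 ∈ D.positiveCone → -w.1 b.1 ∈ D.positiveCone →
            IsLift τ T (w * D.affRefl a) X →
            IsLift τ T (w * alternating (D.affRefl a) (D.affRefl b) m)
              (X * T a * alternating (T a) (T b) m) ∧
            (inversions (w * alternating (D.affRefl a) (D.affRefl b) m)).ncard < N := by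
          intro a b X p q hm ha hb hp hq hna hnb hX
          have hn := negativeAlong hm hna hnb
          obtain ⟨n, rfl⟩ : ∃ n, m = n + 1 := by
            rcases hm with h | h | h | h | h | h <;> exact ⟨m - 1, by omega⟩
          have := isLift_alternating hT N hU n (w * D.affRefl a) b a q p X
            (hN ▸ ncard_inversions_mul_lt ha hna) hX hb ha hq hp (by
              rw [Subgroup.coe_mul, LinearEquiv.mul_apply, LinearEquiv.mul_apply, affRefl_self,
                affRefl_apply, hq, map_sub, map_smul, map_neg, Int.cast_smul_eq_zsmul]
              exact hn.2)
          simpa only [alternating, ← mul_assoc, mul_assoc X, hT.involutive a ha, mul_one] using this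
        obtain ⟨h1, hlt⟩ := key a b X p q hm ha hb hp hq hna hnb hX
        obtain ⟨h2, -⟩ := key b a Y q p hm.symm hb ha hq hp hnb hna hY
        rw [← alternating_affRefl hm hp hq, ← hT.braid a b ha hb m p q hm hp hq] at h2
        have h3 := hU _ hlt _ _ h1 h2
        obtain ⟨z, hz⟩ := alternating_mul_reverse m (T a) (T b) (hT.involutive a ha)
          (hT.involutive b hb)
        have h4 := congrArg (· * z) h3
        simpa only [mul_assoc, hz, mul_one] using h4

theorem Omega_one : (1 : D.extWeyl) ∈ D.Omega := fun _ ha => ha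

theorem Omega_mul {w w' : D.extWeyl} (hw : w ∈ D.Omega) (hw' : w' ∈ D.Omega) :
    w * w' ∈ D.Omega := fun a ha => hw _ (hw' a ha)

/-- An element of `Ω` moves to the left past each `T a`, since it permutes the simple roots and
conjugates the operators accordingly. -/
theorem isLift_mul_omega (hT : LiftRelations τ T) {w w' : D.extWeyl} {X : A}
    (hX : IsLift τ T w X) (hw' : w' ∈ D.Omega) : IsLift τ T (w * w') (X * τ w') := by
  induction hX with
  | omega w hw => rw [← hT.map_mul]; exact IsLift.omega _ (Omega_mul hw hw')
  | step w X a ha hneg h ih =>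
    have hb := Omega_apply_simple (Omega_inv hw') ha
    have hwb : w'.1 ((w'⁻¹).1 a.1) = a.1 := by
      rw [← LinearEquiv.mul_apply, ← Subgroup.coe_mul, mul_inv_cancel]
      rfl
    let b : D.affineRoots := ⟨(w'⁻¹).1 a.1, extWeyl_mem_affineRoots _ a.2⟩
    rw [mul_assoc, ← hT.conj w' hw' b a hb hwb, ← mul_assoc]
    refine IsLift.step _ _ b hb ?_ ?_
    · rw [Subgroup.coe_mul, LinearEquiv.mul_apply, hwb]
      exact hneg
    · rw [mul_assoc, mul_affRefl w' b a hwb, ← mul_assoc]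
      exact ih

/-- If `w a` is positive, the product extends a reduced expression. Otherwise a reduced expression
of `w` can be chosen to end in `a`, and `T_a² = 1` removes that letter. -/
theorem isLift_mul_affRefl (hT : LiftRelations τ T) {w : D.extWeyl} {X : A} {a : D.affineRoots}
    (ha : a.1 ∈ D.simpleAffineRoots) (hX : IsLift τ T w X) :
    IsLift τ T (w * D.affRefl a) (X * T a) := by
  rcases pos_or_neg (extWeyl_mem_affineRoots w a.2) with h | h
  · refine IsLift.step _ _ a ha ?_ ?_
    · rwa [Subgroup.coe_mul, LinearEquiv.mul_apply, affRefl_self, map_neg, neg_neg]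
    · rwa [mul_assoc, affRefl_mul_self, mul_one]
  · obtain ⟨Z, hZ⟩ := exists_isLift τ T (w * D.affRefl a)
    rw [isLift_unique hT hX (IsLift.step w Z a ha h hZ), mul_assoc, hT.involutive a ha, mul_one]
    exact hZ

theorem isLift_mul (hT : LiftRelations τ T) {w w' : D.extWeyl} {X Y : A}
    (hX : IsLift τ T w X) (hY : IsLift τ T w' Y) : IsLift τ T (w * w') (X * Y) := by
  induction hY with
  | omega w' hw' => exact isLift_mul_omega hT hX hw'
  | step w' Y a ha _ _ ih =>
    have := isLift_mul_affRefl hT ha ih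
    rwa [← mul_assoc, mul_assoc _ (D.affRefl a), affRefl_mul_self, mul_one, mul_assoc] at this

/-- A presentation of the extended affine Weyl group by simple reflections and `Ω`. -/
theorem exists_hom_of_liftRelations (hT : LiftRelations τ T) : ∃ ρ : D.extWeyl →* A,
    (∀ w ∈ D.Omega, ρ w = τ w) ∧
      ∀ a : D.affineRoots, a.1 ∈ D.simpleAffineRoots → ρ (D.affRefl a) = T a := by
  choose f hf using exists_isLift τ T
  have h1 : IsLift τ T 1 1 := by
    have := IsLift.omega (τ := τ) (T := T) 1 Omega_one
    rwa [hT.map_one] at this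
  refine ⟨⟨⟨f, isLift_unique hT (hf 1) h1⟩, fun w w' =>
    isLift_unique hT (hf _) (isLift_mul hT (hf w) (hf w'))⟩, fun w hw =>
    isLift_unique hT (hf w) (IsLift.omega w hw), fun a ha => ?_⟩
  have := isLift_mul_affRefl hT ha h1
  rw [one_mul, one_mul] at this
  exact isLift_unique hT (hf _) this

end Lift

/-- The extended affine Weyl group is generated by the simple reflections and `Ω`. -/
theorem extWeyl_induction {P : D.extWeyl → Prop} (omega : ∀ w ∈ D.Omega, P w)
    (step : ∀ w, ∀ a : D.affineRoots, a.1 ∈ D.simpleAffineRoots → P w → P (w * D.affRefl a))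
    (w : D.extWeyl) : P w := by
  -- With values in a trivial monoid, a lift records nothing but a reduced expression.
  obtain ⟨_, hX⟩ := exists_isLift (fun _ : D.extWeyl => ()) (fun _ : D.affineRoots => ()) w
  induction hX with
  | omega w hw => exact omega w hw
  | step w _ a ha _ _ ih =>
    have := step _ a ha ih
    rwa [mul_assoc, affRefl_mul_self, mul_one] at this


end AffineData

/-! ### Calculus on `C^ω(V̂⁺)`: derivatives, Weyl group action and integral-reflections -/

section Analysis

variable {V : Type*} [NormedAddCommGroup V] [InnerProductSpace ℝ V]

open Topology

theorem extZero_dirDeriv (v : VHat V) (f : COmega V) {x : VHat V} (hx : x ∈ VPlus V) :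
    extZero (dirDeriv v f) x = fderiv ℝ (extZero f) x v := by
  rw [extZero_of_mem _ hx]
  exact (f.2 x hx).differentiableAt.lineDeriv_eq_fderiv (v := v)

theorem hasDerivAt_line (f : COmega V) (u v : VHat V) {t : ℝ} (h : u + t • v ∈ VPlus V) :
    HasDerivAt (fun s : ℝ => extZero f (u + s • v)) (extZero (dirDeriv v f) (u + t • v)) t := by
  rw [extZero_dirDeriv v f h]
  have h1 : HasDerivAt (fun s : ℝ => u + s • v) v t := by
    simpa using ((hasDerivAt_id t).smul_const v).const_add u
  exact (f.2 _ h).differentiableAt.hasFDerivAt.comp_hasDerivAt t h1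

theorem COmega.ext_extZero {f g : COmega V} (h : ∀ x ∈ VPlus V, extZero f x = extZero g x) :
    f = g := by
  ext u
  have := h u.1 u.2
  rwa [extZero_of_mem _ u.2, extZero_of_mem _ u.2] at this

theorem extZero_add (f g : COmega V) (x : VHat V) :
    extZero (f + g : COmega V) x = extZero f x + extZero g x := by
  unfold extZero
  split_ifs <;> simp

theorem extZero_smul (r : ℂ) (f : COmega V) (x : VHat V) :
    extZero (r • f : COmega V) x = r * extZero f x := by
  unfold extZero
  split_ifs <;> simp

theorem extZero_sub (f g : COmega V) (x : VHat V) :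
    extZero (f - g : COmega V) x = extZero f x - extZero g x := by
  rw [eq_sub_iff_add_eq, ← extZero_add, sub_add_cancel]

theorem dirDeriv_add (v w : VHat V) : dirDeriv (v + w) = dirDeriv v + dirDeriv w := by
  refine LinearMap.ext fun f => COmega.ext_extZero fun x hx => ?_
  rw [LinearMap.add_apply, extZero_add]
  simp only [extZero_dirDeriv _ _ hx, map_add]

theorem dirDeriv_smul (r : ℝ) (v : VHat V) : dirDeriv (r • v) = (r : ℂ) • dirDeriv v := by
  refine LinearMap.ext fun f => COmega.ext_extZero fun x hx => ?_
  rw [LinearMap.smul_apply, extZero_smul]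
  simp only [extZero_dirDeriv _ _ hx, map_smul, Complex.real_smul]

theorem dirDeriv_comm (v w : VHat V) : dirDeriv v * dirDeriv w = dirDeriv w * dirDeriv v := by
  refine LinearMap.ext fun f => COmega.ext_extZero fun x hx => ?_
  have h2 : DifferentiableAt ℝ (fderiv ℝ (extZero f)) x := (f.2 x hx).fderiv.differentiableAt
  have key : ∀ v w : VHat V, extZero (dirDeriv v (dirDeriv w f)) x =
      fderiv ℝ (fderiv ℝ (extZero f)) x v w := by
    intro v w
    rw [extZero_dirDeriv _ _ hx]
    have h1 : extZero (dirDeriv w f) =ᶠ[𝓝 x] fun y => fderiv ℝ (extZero f) y w :=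
      Filter.eventually_of_mem (isOpen_VPlus.mem_nhds hx) fun y hy => extZero_dirDeriv w f hy
    rw [h1.fderiv_eq, fderiv_clm_apply h2 (differentiableAt_const w)]
    simp
  rw [Module.End.mul_apply, Module.End.mul_apply, key, key]
  exact ((f.2 x hx).contDiffAt (n := ⊤)).isSymmSndFDerivAt (by simp) v w

theorem convex_VPlus : Convex ℝ (VPlus V) := by
  intro x hx y hy s t hs ht hst
  simp only [VPlus, Set.mem_ofPred_eq, Prod.snd_add, Prod.smul_snd, smul_eq_mul] at *
  rcases hs.eq_or_lt with rfl | hs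
  · have : t = 1 := by linarith
    subst this; simpa using hy
  · have := mul_pos hs hx
    have := mul_nonneg ht hy.le
    linarith

/-- An element of `C^ω(V̂⁺)` whose directional derivatives of all orders vanish at a point is
zero. -/
theorem COmega.eq_zero_of_dirDeriv_pow (f : COmega V) (p : VPlus V)
    (h : ∀ (v : VHat V) (n : ℕ), ((dirDeriv v) ^ n) f p = 0) : f = 0 := by
  refine COmega.ext_extZero fun u hu => ?_
  have hz : extZero (0 : COmega V) u = 0 := by rw [extZero_of_mem _ hu]; rfl
  rw [hz]
  -- Restriction to the line from `p` (at `t = 0`) to `u` (at `t = 1`). Its part `S` in `V̂⁺` is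
  -- convex, so a one-variable analytic function on `S` with vanishing Taylor series at 0 vanishes
  -- at 1.
  set v := u - p.1 with hv
  have hline : Continuous fun t : ℝ => p.1 + t • v := by fun_prop
  set S : Set ℝ := (fun t : ℝ => p.1 + t • v) ⁻¹' VPlus V with hS
  have hSo : IsOpen S := isOpen_VPlus.preimage hline
  have hSc : Convex ℝ S := by
    have : S = (AffineMap.lineMap p.1 (p.1 + v) : ℝ →ᵃ[ℝ] VHat V) ⁻¹' VPlus V := by
      ext t
      simp only [hS, Set.mem_preimage, AffineMap.lineMap_apply, vsub_eq_sub, vadd_eq_add,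
        add_sub_cancel_left, add_comm]
    rw [this]
    exact convex_VPlus.affine_preimage _
  have hg : AnalyticOnNhd ℝ (fun t : ℝ => extZero f (p.1 + t • v)) S := fun t ht =>
    AnalyticAt.fun_comp (g := extZero f) (f := fun t : ℝ => p.1 + t • v) (f.2 _ ht)
      (analyticAt_const.add (analyticAt_id.smul analyticAt_const))
  have hiter : ∀ n : ℕ, ∀ t ∈ S, iteratedDeriv n (fun t : ℝ => extZero f (p.1 + t • v)) t =
      extZero (((dirDeriv v) ^ n) f) (p.1 + t • v) := by
    intro n
    induction n with
    | zero => intro t ht; simp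
    | succ n ih =>
      intro t ht
      rw [iteratedDeriv_succ, Filter.EventuallyEq.deriv_eq
        (Filter.eventually_of_mem (hSo.mem_nhds ht) ih)]
      rw [pow_succ', Module.End.mul_apply]
      exact (hasDerivAt_line _ p.1 v ht).deriv
  have h0 : (0 : ℝ) ∈ S := by simp [hS, p.2]
  have h1 : (1 : ℝ) ∈ S := by simp [hS, hv, hu]
  have htop : analyticOrderAt (fun t : ℝ => extZero f (p.1 + t • v)) 0 = ⊤ := by
    refine ENat.eq_top_iff_forall_ge.2 fun n => ?_
    refine (natCast_le_analyticOrderAt_iff_iteratedDeriv_eq_zero (hg 0 h0)).2 fun i _ => ?_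
    rw [hiter i 0 h0, zero_smul, add_zero, extZero_of_mem _ p.2]
    exact h v i
  have := hg.eqOn_zero_of_preconnected_of_eventuallyEq_zero hSc.isPreconnected h0
    (analyticOrderAt_eq_top.1 htop) h1
  simpa [hv] using this

theorem continuous_coroot_line {D : AffineData V} (a : D.affineRoots) (f : COmega V) {x : VHat V}
    (hx : x ∈ VPlus V) : Continuous fun t : ℝ => extZero f (x - t • coroot a.1) :=
  f.2.continuousOn.comp_continuous (by fun_prop) (sub_smul_coroot_mem a.2 hx)

variable [FiniteDimensional ℝ V] {D : AffineData V}

theorem weylAct_apply (w : D.extWeyl) (f : COmega V) (u : VPlus V) :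
    weylAct w f u = f ⟨(w⁻¹).1 u.1, extWeyl_mem_VPlus w⁻¹ u.2⟩ := rfl

theorem weylAct_one : weylAct (1 : D.extWeyl) = 1 := by
  refine LinearMap.ext fun f => COmega.ext fun u => ?_
  rw [weylAct_apply]
  congr 1

theorem weylAct_mul (w w' : D.extWeyl) : weylAct (w * w') = weylAct w * weylAct w' := by
  refine LinearMap.ext fun f => COmega.ext fun u => ?_
  rw [Module.End.mul_apply, weylAct_apply, weylAct_apply, weylAct_apply]
  congr 2

theorem extZero_weylAct (w : D.extWeyl) (f : COmega V) (x : VHat V) :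
    extZero (weylAct w f) x = extZero f ((w⁻¹).1 x) := by
  by_cases hx : x ∈ VPlus V
  · rw [extZero_of_mem _ hx, extZero_of_mem _ (extWeyl_mem_VPlus w⁻¹ hx)]
    rfl
  · have hx' : (w⁻¹).1 x ∉ VPlus V := by
      intro h
      refine hx ?_
      have := extWeyl_snd_snd w⁻¹ x
      simp only [VPlus, Set.mem_ofPred_eq] at h ⊢
      rwa [this] at h
    rw [extZero, extZero, dif_neg hx, dif_neg hx']

theorem weylAct_mul_dirDeriv (w : D.extWeyl) (v : VHat V) :
    weylAct w * dirDeriv v = dirDeriv (w.1 v) * weylAct w := by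
  refine LinearMap.ext fun f => COmega.ext_extZero fun x hx => ?_
  rw [Module.End.mul_apply, Module.End.mul_apply, extZero_weylAct]
  have h1 := hasDerivAt_line (weylAct w f) x (w.1 v) (t := 0) (by simpa using hx)
  have h2 := hasDerivAt_line f ((w⁻¹).1 x) v (t := 0)
    (by simpa using extWeyl_mem_VPlus w⁻¹ hx)
  have h3 : ∀ s : ℝ, extZero (weylAct w f) (x + s • w.1 v) =
      extZero f ((w⁻¹).1 x + s • v) := by
    intro s
    rw [extZero_weylAct, map_add, map_smul, ← LinearEquiv.mul_apply, ← Subgroup.coe_mul,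
      inv_mul_cancel]
    rfl
  simp only [h3] at h1
  have := h2.unique h1
  simpa using this

theorem integralReflection_apply (a : D.affineRoots) (f : COmega V) (u : VPlus V) :
    integralReflection a f u = ∫ t in (0 : ℝ)..(form a.1 u.1),
      extZero f (u.1 - t • coroot a.1) :=
  intervalIntegral.integral_congr fun t _ =>
    (extZero_of_mem _ (sub_smul_coroot_mem a.2 u.2 t)).symm

theorem extZero_integralReflection (a : D.affineRoots) (f : COmega V) {x : VHat V}
    (hx : x ∈ VPlus V) : extZero (integralReflection a f) x =
      ∫ t in (0 : ℝ)..(form a.1 x), extZero f (x - t • coroot a.1) := by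
  rw [extZero_of_mem _ hx]
  exact integralReflection_apply a f ⟨x, hx⟩

theorem weylAct_mul_integralReflection (w : D.extWeyl) (a b : D.affineRoots)
    (h : w.1 a.1 = b.1) :
    weylAct w * integralReflection a = integralReflection b * weylAct w := by
  refine LinearMap.ext fun f => COmega.ext fun u => ?_
  rw [Module.End.mul_apply, Module.End.mul_apply, weylAct_apply, integralReflection_apply,
    integralReflection_apply]
  have hw : ∀ x, (w⁻¹).1 (w.1 x) = x := fun x => by
    rw [← LinearEquiv.mul_apply, ← Subgroup.coe_mul, inv_mul_cancel]; rfl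
  have h1 : (w⁻¹).1 (coroot b.1) = coroot a.1 := by
    rw [← h, coroot, coroot, AffineData.form_extWeyl, map_smul, hw]
  have h2 : form a.1 ((w⁻¹).1 u.1) = form b.1 u.1 := by
    rw [← AffineData.form_extWeyl w⁻¹ b.1, ← h, hw]
  simp only [extZero_weylAct, map_sub, map_smul, h1, h2]

/-- With `x = (a, u)` one has `s_a u = u - x a^∨`. The fundamental theorem of calculus gives `I(a)
∂_{a^∨} f = f - s_a f` and `∂_{a^∨} I(a) f = f + s_a f`; the sum is `2 f`. -/
theorem integralReflection_dirDeriv_coroot (a : D.affineRoots) (f : COmega V) :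
    integralReflection a (dirDeriv (coroot a.1) f) =
      (2 : ℂ) • f - dirDeriv (coroot a.1) (integralReflection a f) := by
  refine COmega.ext_extZero fun u hu => ?_
  have hline : ∀ σ : ℝ, u + σ • coroot a.1 ∈ VPlus V := fun σ => by
    simpa using sub_smul_coroot_mem a.2 hu (-σ)
  rw [extZero_sub, extZero_smul, extZero_integralReflection _ _ hu]
  have ha2 := form_coroot_self (AffineData.form_self_ne_zero a.2)
  set x := form a.1 u with hx
  have h1 : ∫ t in (0 : ℝ)..x, extZero (dirDeriv (coroot a.1) f) (u - t • coroot a.1) =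
      extZero f u - extZero f (u - x • coroot a.1) := by
    have hder : ∀ t ∈ Set.uIcc 0 x, HasDerivAt (fun t : ℝ => -extZero f (u - t • coroot a.1))
        (extZero (dirDeriv (coroot a.1) f) (u - t • coroot a.1)) t := by
      intro t _
      have h2 := hasDerivAt_line f u (coroot a.1) (hline (-t))
      have h3 := (HasDerivAt.scomp t h2 (hasDerivAt_neg t)).neg
      simpa [Function.comp_def, sub_eq_add_neg, Pi.neg_def] using h3
    rw [intervalIntegral.integral_eq_sub_of_hasDerivAt hder
      ((continuous_coroot_line a _ hu).intervalIntegrable _ _)]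
    simp
    ring
  have hc : Continuous fun σ : ℝ => extZero f (u + σ • coroot a.1) := by
    have := (continuous_coroot_line a f hu).comp continuous_neg
    simpa [Function.comp_def] using this
  have h4 : extZero (dirDeriv (coroot a.1) (integralReflection a f)) u =
      extZero f u + extZero f (u - x • coroot a.1) := by
    have h5 := hasDerivAt_line (integralReflection a f) u (coroot a.1) (hline 0)
    -- As `(a, a^∨) = 2`, the upper limit at `u + τ a^∨` is `x + 2 τ`. The substitution `σ = τ - t`
    -- turns the integral into one from `-x - τ` to `τ` with an integrand independent of `τ`.
    have h6 : ∀ τ : ℝ, extZero (integralReflection a f) (u + τ • coroot a.1) =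
        (∫ σ in (0 : ℝ)..τ, extZero f (u + σ • coroot a.1)) -
          ∫ σ in (0 : ℝ)..(-x - τ), extZero f (u + σ • coroot a.1) := by
      intro τ
      rw [extZero_integralReflection _ _ (hline τ), map_add, map_smul, ha2, ← hx,
        intervalIntegral.integral_interval_sub_left (hc.intervalIntegrable _ _)
          (hc.intervalIntegrable _ _)]
      have h7 := intervalIntegral.integral_comp_sub_left
        (fun σ : ℝ => extZero f (u + σ • coroot a.1)) τ (a := 0) (b := x + τ • 2)
      have e : τ - (x + τ • 2) = -x - τ := by simp only [smul_eq_mul]; ring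
      rw [sub_zero, e] at h7
      rw [← h7]
      refine intervalIntegral.integral_congr fun t _ => ?_
      congr 1
      module
    simp only [h6] at h5
    have h8 : ∀ s : ℝ, HasDerivAt (fun τ : ℝ => ∫ σ in (0 : ℝ)..τ,
        extZero f (u + σ • coroot a.1)) (extZero f (u + s • coroot a.1)) s := fun s =>
      intervalIntegral.integral_hasDerivAt_right (hc.intervalIntegrable _ _)
        (hc.stronglyMeasurableAtFilter _ _) hc.continuousAt
    have h9 : HasDerivAt (fun τ : ℝ => -x - τ) (-1) 0 := by
      simpa using (hasDerivAt_id (0 : ℝ)).const_sub (-x)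
    have h10 := HasDerivAt.scomp (0 : ℝ) (h8 (-x - 0)) h9
    have h11 := h5.unique ((h8 0).sub h10)
    simpa [sub_eq_add_neg] using h11
  rw [h1, h4]
  ring

/-- Moving in the direction `v` leaves the upper limit `(a, u)` unchanged, so it is enough to
differentiate under the integral sign. -/
theorem integralReflection_dirDeriv_of_form_eq_zero (a : D.affineRoots) (f : COmega V)
    {v : VHat V} (hv : form a.1 v = 0) :
    integralReflection a (dirDeriv v f) = dirDeriv v (integralReflection a f) := by
  refine COmega.ext_extZero fun u hu => ?_
  rw [extZero_integralReflection _ _ hu]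
  have hline : Continuous fun t : ℝ => u + t • v := by fun_prop
  obtain ⟨ε, hε, hball⟩ := Metric.nhds_basis_closedBall.mem_iff.1
    ((isOpen_VPlus.preimage hline).mem_nhds (x := 0) (by simpa using hu))
  have hmem : ∀ τ ∈ Metric.closedBall (0 : ℝ) ε, ∀ t : ℝ,
      u - t • coroot a.1 + τ • v ∈ VPlus V := by
    intro τ hτ t
    have := sub_smul_coroot_mem a.2 (hball hτ) t
    simpa only [add_sub_right_comm] using this
  have hcont : ContinuousOn (fun z : ℝ × ℝ =>
      extZero (dirDeriv v f) (u - z.2 • coroot a.1 + z.1 • v))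
      (Metric.closedBall (0 : ℝ) ε ×ˢ Set.uIcc 0 (form a.1 u)) :=
    (dirDeriv v f).2.continuousOn.comp (by fun_prop) fun z hz => hmem z.1 hz.1 z.2
  -- A dominating constant for the derivative, by continuity on a compact rectangle of parameters.
  obtain ⟨C, hC⟩ := ((isCompact_closedBall (0 : ℝ) ε).prod isCompact_uIcc).exists_bound_of_continuousOn
    hcont
  have hct : ∀ (g : COmega V), ∀ τ ∈ Metric.closedBall (0 : ℝ) ε,
      Continuous fun t : ℝ => extZero g (u - t • coroot a.1 + τ • v) := fun g τ hτ =>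
    g.2.continuousOn.comp_continuous (by fun_prop) (hmem τ hτ)
  have h0 : (0 : ℝ) ∈ Metric.closedBall (0 : ℝ) ε := Metric.mem_closedBall_self hε.le
  have key := (intervalIntegral.hasDerivAt_integral_of_dominated_loc_of_deriv_le
    (μ := MeasureTheory.volume) (a := 0) (b := form a.1 u)
    (F := fun τ t => extZero f (u - t • coroot a.1 + τ • v))
    (F' := fun τ t => extZero (dirDeriv v f) (u - t • coroot a.1 + τ • v))
    (bound := fun _ => C) (x₀ := 0) (Metric.closedBall_mem_nhds (0 : ℝ) hε)
    (Filter.eventually_of_mem (Metric.closedBall_mem_nhds (0 : ℝ) hε) fun τ hτ =>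
      (hct f τ hτ).aestronglyMeasurable)
    ((hct f 0 h0).intervalIntegrable _ _) (hct _ 0 h0).aestronglyMeasurable
    (Filter.Eventually.of_forall fun t ht τ hτ => hC (τ, t) ⟨hτ, Set.uIoc_subset_uIcc ht⟩)
    intervalIntegrable_const
    (Filter.Eventually.of_forall fun t _ τ hτ => hasDerivAt_line f _ v (hmem τ hτ t))).2
  have h1 := hasDerivAt_line (integralReflection a f) u v (t := 0) (by simpa using hu)
  have h2 : (fun τ : ℝ => extZero (integralReflection a f) (u + τ • v)) =ᶠ[𝓝 0]
      fun τ => ∫ t in (0 : ℝ)..(form a.1 u), extZero f (u - t • coroot a.1 + τ • v) := by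
    refine Filter.eventually_of_mem (Metric.closedBall_mem_nhds (0 : ℝ) hε) fun τ hτ => ?_
    change extZero (integralReflection a f) (u + τ • v) = _
    rw [extZero_integralReflection _ _ (hball hτ), map_add, map_smul, hv, smul_zero, add_zero]
    simp only [add_sub_right_comm]
  have h3 := key.unique (h1.congr_of_eventuallyEq h2.symm)
  simpa using h3

/-- Split `v` into a multiple of `a^∨` and a vector orthogonal to `a`. The reflection negates the
first part and fixes the second, so the two preceding commutation rules combine. -/
theorem integralReflection_mul_dirDeriv (a : D.affineRoots) (v : VHat V) :
    integralReflection a * dirDeriv v =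
      dirDeriv ((D.affRefl a).1 v) * integralReflection a + ((form a.1 v : ℝ) : ℂ) • 1 := by
  have ha2 := form_coroot_self (AffineData.form_self_ne_zero a.2)
  set r : ℝ := form a.1 v / 2 with hr
  set v' := v - r • coroot a.1 with hv'
  have hv0 : form a.1 v' = 0 := by
    rw [hv', map_sub, map_smul, ha2, hr, smul_eq_mul]; ring
  have h1 : v = v' + r • coroot a.1 := by rw [hv', sub_add_cancel]
  have h2 : (D.affRefl a).1 v = v' + (-r) • coroot a.1 := by
    rw [AffineData.affRefl_apply, form_coroot_smul, hv', hr]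
    module
  have h3 : form a.1 v = 2 * r := by rw [hr]; ring
  refine LinearMap.ext fun f => ?_
  rw [h2, h3]
  conv_lhs => rw [h1]
  simp only [dirDeriv_add, dirDeriv_smul, Module.End.mul_apply, LinearMap.add_apply,
    LinearMap.smul_apply, map_add, map_smul, integralReflection_dirDeriv_coroot,
    integralReflection_dirDeriv_of_form_eq_zero a f hv0, Module.End.one_apply]
  push_cast
  module

theorem weylAct_affRefl_apply_of_form_eq_zero (a : D.affineRoots) (f : COmega V) (p : VPlus V)
    (hp : form a.1 p.1 = 0) : weylAct (D.affRefl a) f p = f p := by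
  rw [weylAct_apply]
  have h : (D.affRefl a)⁻¹ = D.affRefl a :=
    inv_eq_of_mul_eq_one_left (AffineData.affRefl_mul_self a)
  refine congrArg (fun u => f u) (Subtype.ext ?_)
  simp only [h, AffineData.affRefl_apply]
  rw [form_coroot_smul, hp, zero_smul, sub_zero]

theorem integralReflection_apply_of_form_eq_zero (a : D.affineRoots) (f : COmega V) (p : VPlus V)
    (hp : form a.1 p.1 = 0) : integralReflection a f p = 0 := by
  rw [integralReflection_apply, hp, intervalIntegral.integral_same]

end Analysis

/-! ### Cancellation of lower order terms in the braid relations -/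

section Braid

variable {A G X : Type*} [Ring A] [Algebra ℂ A] [Group G] [MulAction G X]

/-- Suppose that two involutions `s`, `t` satisfy the cross relations of a graded Hecke algebra of
rank two with the elements `d x`. Then the lower order terms in the difference of the two sides of
the braid relation cancel. -/
theorem alternating_sub_mul (d : X → A) (s t : A) (σ τ : G) (f g : X → ℂ) (c e : ℂ)
    (hss : s * s = 1) (htt : t * t = 1)
    (hs : ∀ x, s * d x = d (σ • x) * s - (c * f x) • (1 : A))
    (ht : ∀ x, t * d x = d (τ • x) * t - (e * g x) • (1 : A))
    {m : ℕ} {p q : ℤ} (hm : IsBraidLength m p q)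
    (hff : ∀ x, f (σ • x) = -f x) (hgg : ∀ x, g (τ • x) = -g x)
    (hfg : ∀ x, f (τ • x) = f x - p * g x) (hgf : ∀ x, g (σ • x) = g x - q * f x)
    (hce : p = -1 → q = -1 → c = e)
    (hστ : alternating σ τ m = alternating τ σ m) (x : X) :
    (alternating s t m - alternating t s m) * d x =
      d (alternating σ τ m • x) * (alternating s t m - alternating t s m) := by
  have hss' : ∀ z, s * (s * z) = z := fun z => by rw [← mul_assoc, hss, one_mul]
  have htt' : ∀ z, t * (t * z) = z := fun z => by rw [← mul_assoc, htt, one_mul]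
  have hs' : ∀ x z, s * (d x * z) = d (σ • x) * (s * z) - (c * f x) • z := fun x z => by
    rw [← mul_assoc, hs, sub_mul, smul_mul_assoc, one_mul, mul_assoc]
  have ht' : ∀ x z, t * (d x * z) = d (τ • x) * (t * z) - (e * g x) • z := fun x z => by
    rw [← mul_assoc, ht, sub_mul, smul_mul_assoc, one_mul, mul_assoc]
  have hd : d (alternating σ τ m • x) * (alternating s t m - alternating t s m) =
      d (alternating σ τ m • x) * alternating s t m -
        d (alternating τ σ m • x) * alternating t s m := by
    rw [mul_sub]
    conv_lhs => rw [hστ]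
    rw [hστ]
  rw [hd, sub_mul]
  clear hd hστ
  rcases hm with ⟨rfl, rfl, rfl⟩ | ⟨rfl, rfl, rfl⟩ | ⟨rfl, rfl, rfl⟩ | ⟨rfl, rfl, rfl⟩ |
    ⟨rfl, rfl, rfl⟩ | ⟨rfl, rfl, rfl⟩
  -- Only the relation of length 3 requires equal parameters.
  all_goals try obtain rfl := hce rfl rfl
  -- Each `d x` is moved to the left through the words by the cross relations, and repeated letters
  -- are removed by `s² = t² = 1`. What remains is an identity between linear combinations of
  -- shorter words.
  all_goals
    simp only [alternating, mul_one, mul_smul, mul_assoc, hs, ht, hs', ht', mul_sub,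
      mul_smul_comm, hss', htt', hss, htt, hff, hgg, hfg, hgf]
    push_cast
    module

end Braid

/-! ### Points of `V̂⁺` on root hyperplanes, and multiplicities -/

namespace AffineData

variable {V : Type*} [NormedAddCommGroup V] [InnerProductSpace ℝ V] {D : AffineData V}

/-- The hyperplane of an affine root meets `V̂⁺`. -/
theorem exists_mem_VPlus_form_eq_zero (a : D.affineRoots) : ∃ u : VPlus V, form a.1 u.1 = 0 := by
  have hA := (D.isRootSystem.inner_self_pos a.2.1).ne'
  -- For `a = α + η c` the point `r α + d` pairs with `a` to `r (α, α) + η`.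
  refine ⟨⟨(-(a.1.2.1 / inner ℝ a.1.1 a.1.1) • a.1.1, 0, 1), by simp [VPlus]⟩, ?_⟩
  simp only [form_apply, real_inner_smul_right]
  field_simp
  ring

/-- The hyperplanes of two affine roots that generate a finite reflection group meet in `V̂⁺`. -/
theorem exists_mem_VPlus_form_eq_zero₂ {a b : D.affineRoots} {m : ℕ} {p q : ℤ}
    (hm : IsBraidLength m p q) (hp : form a.1 (coroot b.1) = (p : ℝ))
    (hq : form b.1 (coroot a.1) = (q : ℝ)) :
    ∃ u : VPlus V, form a.1 u.1 = 0 ∧ form b.1 u.1 = 0 := by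
  have hA := D.isRootSystem.inner_self_pos a.2.1
  have hB := D.isRootSystem.inner_self_pos b.2.1
  rw [form_coroot_eq a.2 b.2] at hp
  rw [form_coroot_eq b.2 a.2, real_inner_comm] at hq
  set A : ℝ := inner ℝ a.1.1 a.1.1
  set B : ℝ := inner ℝ b.1.1 b.1.1
  set C : ℝ := inner ℝ a.1.1 b.1.1 with hC
  have hpq : (p : ℝ) * q ≠ 4 := by
    have : p * q ≠ 4 := by
      rcases hm with h | h | h | h | h | h <;> rw [h.2.1, h.2.2] <;> norm_num
    exact_mod_cast this
  -- The Gram determinant of the finite parts: its vanishing would mean `p q = 4 C² / (A B) = 4`.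
  have hG : A * B - C ^ 2 ≠ 0 := by
    intro h0
    refine hpq ?_
    rw [← hp, ← hq, div_mul_div_comm, div_eq_iff (by positivity)]
    linarith
  obtain ⟨G, hGe⟩ : ∃ G, G = A * B - C ^ 2 := ⟨_, rfl⟩
  rw [← hGe] at hG
  -- Cramer's rule for a point `r a.1 + r' b.1 + d` orthogonal to `a` and `b`.
  refine ⟨⟨(((-a.1.2.1 * B + b.1.2.1 * C) / G) • a.1.1 +
    ((-b.1.2.1 * A + a.1.2.1 * C) / G) • b.1.1, 0, 1), by simp [VPlus]⟩, ?_, ?_⟩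
  · simp only [form_apply, inner_add_right, real_inner_smul_right]
    change _ * A + _ * C + _ + _ = _
    field_simp
    rw [hGe]
    ring
  · simp only [form_apply, inner_add_right, real_inner_smul_right, real_inner_comm a.1.1 b.1.1]
    change _ * C + _ * B + _ + _ = _
    field_simp
    rw [hGe]
    ring

theorem form_affRefl_self (a : D.affineRoots) (x : VHat V) :
    form a.1 ((D.affRefl a).1 x) = -form a.1 x := by
  have := form_extWeyl (D.affRefl a) a.1 x
  rw [affRefl_self, map_neg, LinearMap.neg_apply] at this
  linarith

theorem form_affRefl (a b : D.affineRoots) (x : VHat V) :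
    form a.1 ((D.affRefl b).1 x) = form a.1 x - form a.1 (coroot b.1) * form b.1 x := by
  rw [affRefl_apply, form_coroot_smul, map_sub, map_smul, smul_eq_mul, mul_comm]

/-- When both Cartan integers are `-1`, `s_b a = a + b` and `s_a (a + b) = b`, so `a` and `b` are
conjugate. -/
theorem IsMultiplicity.eq_of_cartan {k : D.affineRoots → ℂ} (hk : IsMultiplicity k)
    {a b : D.affineRoots} (hp : form a.1 (coroot b.1) = -1) (hq : form b.1 (coroot a.1) = -1) :
    k a = k b := by
  refine hk (D.affRefl a * D.affRefl b) a b ?_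
  rw [Subgroup.coe_mul, LinearEquiv.mul_apply, affRefl_apply b, hp, map_sub, map_smul,
    affRefl_self, affRefl_apply, hq]
  module

end AffineData

/-! ### The operators on `C^ω(V̂⁺) ⊗ M` and their relations -/

section Operators

variable {V : Type*} [NormedAddCommGroup V] [InnerProductSpace ℝ V]
  {M : Type*} [AddCommGroup M] [Module ℂ M]

/-- Evaluation at a point, as a linear functional on `C^ω(V̂⁺)`. -/
def COmega.eval (p : VPlus V) : COmega V →ₗ[ℂ] ℂ where
  toFun f := f p
  map_add' _ _ := rfl
  map_smul' _ _ := rfl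

variable (M) in
/-- Evaluation at a point, on `C^ω(V̂⁺) ⊗ M`. -/
def evalTensor (p : VPlus V) : TensorProduct ℂ (COmega V) M →ₗ[ℂ] M :=
  (TensorProduct.lid ℂ M).toLinearMap ∘ₗ TensorProduct.map (COmega.eval p) LinearMap.id

theorem evalTensor_tmul (p : VPlus V) (f : COmega V) (m : M) :
    evalTensor M p (f ⊗ₜ m) = f p • m := by
  rw [evalTensor, LinearMap.comp_apply, TensorProduct.map_tmul]
  exact TensorProduct.lid_tmul _ _

variable (M) in
/-- The operator `∂_v ⊗ id` on `C^ω(V̂⁺) ⊗ M`. -/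
def tensorDeriv (v : VHat V) : Module.End ℂ (TensorProduct ℂ (COmega V) M) :=
  TensorProduct.map (dirDeriv v) LinearMap.id

theorem tensorDeriv_add (v w : VHat V) :
    tensorDeriv M (v + w) = tensorDeriv M v + tensorDeriv M w := by
  rw [tensorDeriv, dirDeriv_add, TensorProduct.map_add_left]
  rfl

theorem tensorDeriv_smul (r : ℝ) (v : VHat V) :
    tensorDeriv M (r • v) = (r : ℂ) • tensorDeriv M v := by
  rw [tensorDeriv, dirDeriv_smul, TensorProduct.map_smul_left]
  rfl

theorem tensorDeriv_comm (v w : VHat V) :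
    tensorDeriv M v * tensorDeriv M w = tensorDeriv M w * tensorDeriv M v := by
  simp only [tensorDeriv, ← TensorProduct.map_mul, dirDeriv_comm v w]

/-- An element of `C^ω(V̂⁺) ⊗ M` whose derivatives of all orders vanish at a point is zero. -/
theorem eq_zero_of_tensorDeriv_pow (X : TensorProduct ℂ (COmega V) M) (p : VPlus V)
    (h : ∀ (v : VHat V) (n : ℕ), evalTensor M p ((tensorDeriv M v ^ n) X) = 0) : X = 0 := by
  classical
  let b := Module.Basis.ofVectorSpace ℂ M
  -- The coordinates with respect to a basis of `M` commute with the derivatives and are jointly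
  -- injective, which reduces the claim to scalar functions.
  let φ : ∀ i, TensorProduct ℂ (COmega V) M →ₗ[ℂ] COmega V := fun i =>
    (TensorProduct.rid ℂ (COmega V)).toLinearMap ∘ₗ TensorProduct.map LinearMap.id (b.coord i)
  have hφ : ∀ i f m, φ i (f ⊗ₜ m) = b.coord i m • f := fun i f m => by simp [φ]
  have hφe : ∀ i Z, φ i Z = TensorProduct.equivFinsuppOfBasisRight b Z i := by
    intro i Z
    induction Z using TensorProduct.induction_on with
    | zero => simp
    | tmul f m => simp [hφ]
    | add x y hx hy => rw [map_add, map_add, hx, hy, Finsupp.add_apply]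
  have hcomm : ∀ i v (n : ℕ) Z, φ i ((tensorDeriv M v ^ n) Z) = (dirDeriv v ^ n) (φ i Z) := by
    intro i v n
    induction n with
    | zero => intro Z; simp
    | succ n ih =>
      intro Z
      rw [pow_succ, pow_succ, Module.End.mul_apply, Module.End.mul_apply, ih]
      congr 1
      induction Z using TensorProduct.induction_on with
      | zero => simp
      | tmul f m => simp [tensorDeriv, hφ]
      | add x y hx hy => simp only [map_add, hx, hy]
  have hev : ∀ i Z, (φ i Z) p = b.coord i (evalTensor M p Z) := by
    intro i Z
    change COmega.eval p (φ i Z) = _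
    induction Z using TensorProduct.induction_on with
    | zero => simp
    | tmul f m =>
      rw [hφ, evalTensor_tmul, map_smul, map_smul, smul_eq_mul, smul_eq_mul, mul_comm]
      rfl
    | add x y hx hy => simp only [map_add, hx, hy]
  have h0 : ∀ i, φ i X = 0 := fun i => COmega.eq_zero_of_dirDeriv_pow _ p fun v n => by
    rw [← hcomm, hev, h, map_zero]
  refine (TensorProduct.equivFinsuppOfBasisRight (M := COmega V) b).injective ?_
  ext i : 1
  rw [← hφe, h0, map_zero, Finsupp.zero_apply]

/-- An operator that intertwines derivatives with derivatives and vanishes at a point is zero. -/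
theorem eq_zero_of_mul_tensorDeriv (E : Module.End ℂ (TensorProduct ℂ (COmega V) M))
    (hE : ∀ v, ∃ v', tensorDeriv M v * E = E * tensorDeriv M v') (p : VPlus V)
    (hp : ∀ X, evalTensor M p (E X) = 0) : E = 0 := by
  refine LinearMap.ext fun X => eq_zero_of_tensorDeriv_pow _ p fun v n => ?_
  obtain ⟨v', hv'⟩ := hE v
  have h : tensorDeriv M v ^ n * E = E * tensorDeriv M v' ^ n :=
    (SemiconjBy.pow_right (show SemiconjBy E _ _ from hv'.symm) n).symm
  rw [← Module.End.mul_apply, h, Module.End.mul_apply]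
  exact hp _

variable [FiniteDimensional ℝ V] {D : AffineData V} (π : Representation ℂ D.extWeyl M)
  (k : D.affineRoots → ℂ)

/-- The diagonal action of `w` on `C^ω(V̂⁺) ⊗ M`. -/
def tensorWeyl (w : D.extWeyl) : Module.End ℂ (TensorProduct ℂ (COmega V) M) :=
  TensorProduct.map (weylAct w) (π w)

/-- The operator `s_a ⊗ π(s_a) - k_a I(a) ⊗ id`. -/
def tensorRefl (a : D.affineRoots) : Module.End ℂ (TensorProduct ℂ (COmega V) M) :=
  TensorProduct.map (weylAct (D.affRefl a)) (π (D.affRefl a)) -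
    k a • TensorProduct.map (integralReflection a) LinearMap.id

theorem tensorWeyl_one : tensorWeyl π 1 = 1 := by
  rw [tensorWeyl, weylAct_one, map_one]
  exact TensorProduct.map_one

theorem tensorWeyl_mul (w w' : D.extWeyl) :
    tensorWeyl π (w * w') = tensorWeyl π w * tensorWeyl π w' := by
  rw [tensorWeyl, weylAct_mul, map_mul]
  exact TensorProduct.map_mul _ _ _ _

theorem tensorWeyl_mul_tensorDeriv (w : D.extWeyl) (v : VHat V) :
    tensorWeyl π w * tensorDeriv M v = tensorDeriv M (w.1 v) * tensorWeyl π w := by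
  rw [tensorWeyl, tensorDeriv, tensorDeriv, ← TensorProduct.map_mul, ← TensorProduct.map_mul,
    weylAct_mul_dirDeriv]
  rfl

/-- The reflection part intertwines derivatives exactly; the scalar term comes from `I(a)` alone. -/
theorem tensorRefl_mul_tensorDeriv (a : D.affineRoots) (v : VHat V) :
    tensorRefl π k a * tensorDeriv M v = tensorDeriv M ((D.affRefl a).1 v) * tensorRefl π k a -
      (k a * (form a.1 v : ℝ)) • (1 : Module.End ℂ (TensorProduct ℂ (COmega V) M)) := by
  have h1 := tensorWeyl_mul_tensorDeriv π (D.affRefl a) v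
  have h2 : (TensorProduct.map (integralReflection a) LinearMap.id * tensorDeriv M v :
      Module.End ℂ (TensorProduct ℂ (COmega V) M)) =
      tensorDeriv M ((D.affRefl a).1 v) * TensorProduct.map (integralReflection a) LinearMap.id +
        ((form a.1 v : ℝ) : ℂ) • 1 := by
    rw [tensorDeriv, tensorDeriv, ← TensorProduct.map_mul, integralReflection_mul_dirDeriv,
      TensorProduct.map_add_left, TensorProduct.map_smul_left, ← TensorProduct.map_mul]
    congr 2
    exact TensorProduct.map_one
  change (tensorWeyl π _ - _) * _ = _ * (tensorWeyl π _ - _) - _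
  rw [sub_mul, mul_sub, h1, smul_mul_assoc, h2, mul_smul_comm, mul_smul, smul_add]
  abel

theorem tensorWeyl_mul_tensorRefl (hk : AffineData.IsMultiplicity k) (w : D.extWeyl)
    (a b : D.affineRoots) (h : w.1 a.1 = b.1) :
    tensorWeyl π w * tensorRefl π k a = tensorRefl π k b * tensorWeyl π w := by
  change _ * (tensorWeyl π _ - _) = (tensorWeyl π _ - _) * _
  rw [mul_sub, sub_mul, ← tensorWeyl_mul, ← tensorWeyl_mul, AffineData.mul_affRefl w a b h,
    hk w a b h, mul_smul_comm, smul_mul_assoc, tensorWeyl, tensorWeyl, ← TensorProduct.map_mul,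
    ← TensorProduct.map_mul, weylAct_mul_integralReflection w a b h]
  rfl

/-- On the hyperplane of `a` the point is fixed by `s_a` and the interval of integration is
degenerate. -/
theorem evalTensor_tensorRefl (a : D.affineRoots) (p : VPlus V) (hp : form a.1 p.1 = 0)
    (X : TensorProduct ℂ (COmega V) M) :
    evalTensor M p (tensorRefl π k a X) = π (D.affRefl a) (evalTensor M p X) := by
  induction X using TensorProduct.induction_on with
  | zero => simp
  | tmul f m =>
    rw [tensorRefl, LinearMap.sub_apply, LinearMap.smul_apply, TensorProduct.map_tmul,
      TensorProduct.map_tmul, map_sub, map_smul, evalTensor_tmul, evalTensor_tmul,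
      evalTensor_tmul, weylAct_affRefl_apply_of_form_eq_zero a f p hp,
      integralReflection_apply_of_form_eq_zero a f p hp, zero_smul, smul_zero, sub_zero, map_smul]
  | add x y hx hy => simp only [map_add, hx, hy]

theorem evalTensor_alternating (p : VPlus V) (n : ℕ) : ∀ (a b : D.affineRoots),
    form a.1 p.1 = 0 → form b.1 p.1 = 0 → ∀ X : TensorProduct ℂ (COmega V) M,
    evalTensor M p (alternating (tensorRefl π k a) (tensorRefl π k b) n X) =
      π (alternating (D.affRefl a) (D.affRefl b) n) (evalTensor M p X) := by
  induction n with
  | zero => intro a b _ _ X; simp [alternating]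
  | succ n ih =>
    intro a b ha hb X
    rw [alternating, alternating, Module.End.mul_apply, evalTensor_tensorRefl π k a p ha,
      ih b a hb ha, map_mul, Module.End.mul_apply]

/-- The difference `T_a² - 1` commutes with every derivative, since the two scalar terms cancel by
`(a, s_a v) = -(a, v)`, and it vanishes at a point of the hyperplane of `a` because `π(s_a)² = 1`.
-/
theorem tensorRefl_mul_self (a : D.affineRoots) : tensorRefl π k a * tensorRefl π k a = 1 := by
  obtain ⟨p, hp⟩ := AffineData.exists_mem_VPlus_form_eq_zero a
  refine sub_eq_zero.1 (eq_zero_of_mul_tensorDeriv _ (fun v => ⟨v, ?_⟩) p fun X => ?_)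
  · rw [mul_sub, sub_mul, mul_one, one_mul]
    congr 1
    rw [mul_assoc, tensorRefl_mul_tensorDeriv, mul_sub,
      ← mul_assoc _ (tensorDeriv M ((D.affRefl a).1 v)), tensorRefl_mul_tensorDeriv,
      AffineData.affRefl_affRefl, AffineData.form_affRefl_self, sub_mul, mul_smul_comm, mul_one,
      smul_mul_assoc, one_mul, mul_assoc]
    push_cast
    module
  · rw [LinearMap.sub_apply, map_sub, Module.End.mul_apply, evalTensor_tensorRefl π k a p hp,
      evalTensor_tensorRefl π k a p hp, ← Module.End.mul_apply, ← map_mul,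
      AffineData.affRefl_mul_self, map_one]
    exact sub_self _

/-- The difference of the two sides intertwines derivatives, and at a common point of the two
hyperplanes it becomes the braid relation under `π`. -/
theorem alternating_tensorRefl (hk : AffineData.IsMultiplicity k) (a b : D.affineRoots) {m : ℕ}
    {p q : ℤ} (hm : IsBraidLength m p q) (hp : form a.1 (coroot b.1) = (p : ℝ))
    (hq : form b.1 (coroot a.1) = (q : ℝ)) :
    alternating (tensorRefl π k a) (tensorRefl π k b) m =
      alternating (tensorRefl π k b) (tensorRefl π k a) m := by
  obtain ⟨u, hua, hub⟩ := AffineData.exists_mem_VPlus_form_eq_zero₂ hm hp hq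
  have hst := AffineData.alternating_affRefl hm hp hq
  have key := alternating_sub_mul (X := VHat V) (tensorDeriv M) (tensorRefl π k a)
    (tensorRefl π k b) (D.affRefl a) (D.affRefl b) (fun x => ((form a.1 x : ℝ) : ℂ))
    (fun x => ((form b.1 x : ℝ) : ℂ)) (k a) (k b) (tensorRefl_mul_self π k a)
    (tensorRefl_mul_self π k b) (tensorRefl_mul_tensorDeriv π k a)
    (tensorRefl_mul_tensorDeriv π k b) hm
    (fun x => by
      rw [← Complex.ofReal_neg, ← AffineData.form_affRefl_self]; rfl)
    (fun x => by
      rw [← Complex.ofReal_neg, ← AffineData.form_affRefl_self]; rfl)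
    (fun x => by
      have := AffineData.form_affRefl a b x
      rw [hp] at this
      exact_mod_cast congrArg Complex.ofReal this)
    (fun x => by
      have := AffineData.form_affRefl b a x
      rw [hq] at this
      exact_mod_cast congrArg Complex.ofReal this)
    (fun h1 h2 => hk.eq_of_cartan (by rw [hp, h1]; norm_num) (by rw [hq, h2]; norm_num)) hst
  refine sub_eq_zero.1 (eq_zero_of_mul_tensorDeriv _
    -- `key` moves `d x` to the left as `d (w x)`, with `w` the alternating product; hence the
    -- vector `w⁻¹ v`.
    (fun v => ⟨(alternating (D.affRefl a) (D.affRefl b) m)⁻¹ • v, ?_⟩) u fun X => ?_)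
  · rw [key, smul_inv_smul]
  · rw [LinearMap.sub_apply, map_sub, evalTensor_alternating π k u m a b hua hub,
      evalTensor_alternating π k u m b a hub hua, hst, sub_self]

theorem liftRelations_tensorRefl (hk : AffineData.IsMultiplicity k) :
    AffineData.LiftRelations (tensorWeyl π) (tensorRefl π k) where
  map_one := tensorWeyl_one π
  map_mul := tensorWeyl_mul π
  involutive a _ := tensorRefl_mul_self π k a
  conj w _ a b _ h := tensorWeyl_mul_tensorRefl π k hk w a b h
  braid a b _ _ _ _ _ hm hp hq := alternating_tensorRefl π k hk a b hm hp hq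

end Operators

/-! ### Passage to the Cherednik algebra: uniqueness and existence -/

section Representation

variable {V : Type*} [NormedAddCommGroup V] [InnerProductSpace ℝ V]
  {M : Type*} [AddCommGroup M] [Module ℂ M]

variable (V M) in
/-- The operators `∂_v ⊗ id` as a real linear map. -/
def tensorDerivReal : VHat V →ₗ[ℝ] Module.End ℂ (TensorProduct ℂ (COmega V) M) where
  toFun := tensorDeriv M
  map_add' := tensorDeriv_add
  map_smul' := tensorDeriv_smul

variable (V M) in
/-- The complex linear extension of `v ↦ ∂_v ⊗ id` to `ĥ`. -/
def tensorDerivComplex : HHat V →ₗ[ℂ] Module.End ℂ (TensorProduct ℂ (COmega V) M) :=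
  (tensorDerivReal V M).liftBaseChange ℂ

theorem tensorDerivComplex_tmul (z : ℂ) (v : VHat V) :
    tensorDerivComplex V M (z ⊗ₜ[ℝ] v) = z • tensorDeriv M v :=
  LinearMap.liftBaseChange_tmul ℂ (tensorDerivReal V M) z v

theorem tensorDerivComplex_comm (x y : HHat V) :
    tensorDerivComplex V M x * tensorDerivComplex V M y =
      tensorDerivComplex V M y * tensorDerivComplex V M x := by
  induction x using TensorProduct.induction_on with
  | zero => simp
  | tmul z v =>
    induction y using TensorProduct.induction_on with
    | zero => simp
    | tmul z' v' =>
      simp only [tensorDerivComplex_tmul, smul_mul_assoc, mul_smul_comm, tensorDeriv_comm v v']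
      rw [smul_comm]
    | add x y hx hy => rw [map_add, mul_add, add_mul, hx, hy]
  | add x y hx hy => rw [map_add, mul_add, add_mul, hx, hy]

theorem formC_tmul (a : VHat V) (z : ℂ) (v : VHat V) :
    formC a (z ⊗ₜ[ℝ] v) = z * (form a v : ℝ) := by
  simp [formC, mul_comm]

/-- Algebra homomorphisms on `Ĥ^Y(k)` are determined by their values on `V̂`, on the simple
reflections and on `Ω`. -/
theorem cherednik_algHom_ext {D : AffineData V} (k : D.affineRoots → ℂ) {B : Type*} [Ring B] [Algebra ℂ B]
    {Q Q' : AffineData.Cherednik k →ₐ[ℂ] B}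
    (hs : ∀ a : D.affineRoots, (a : VHat V) ∈ D.simpleAffineRoots →
      Q (AffineData.Cherednik.grp k (D.affRefl a)) = Q' (AffineData.Cherednik.grp k (D.affRefl a)))
    (hΩ : ∀ w ∈ D.Omega, Q (AffineData.Cherednik.grp k w) = Q' (AffineData.Cherednik.grp k w))
    (hv : ∀ v : VHat V, Q (AffineData.Cherednik.vec k ((1 : ℂ) ⊗ₜ[ℝ] v)) =
      Q' (AffineData.Cherednik.vec k ((1 : ℂ) ⊗ₜ[ℝ] v))) : Q = Q' := by
  have hgrp : ∀ w, Q (AffineData.Cherednik.grp k w) = Q' (AffineData.Cherednik.grp k w) := by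
    refine AffineData.extWeyl_induction hΩ fun w a ha h => ?_
    rw [map_mul, map_mul, map_mul, h, hs a ha]
  have hvec : ∀ x, Q (AffineData.Cherednik.vec k x) = Q' (AffineData.Cherednik.vec k x) := by
    intro x
    induction x using TensorProduct.induction_on with
    | zero => simp
    | tmul z v =>
      have : z ⊗ₜ[ℝ] v = z • ((1 : ℂ) ⊗ₜ[ℝ] v) := by
        rw [TensorProduct.smul_tmul', smul_eq_mul, mul_one]
      rw [this, map_smul, map_smul, map_smul, hv]
    | add x y hx hy => simp only [map_add, hx, hy]
  refine RingQuot.ringQuot_ext' ℂ _ _ (FreeAlgebra.hom_ext (funext fun i => ?_))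
  rcases i with x | w
  · exact hvec x
  · exact hgrp w

variable [FiniteDimensional ℝ V] {D : AffineData V} (π : Representation ℂ D.extWeyl M)
  (k : D.affineRoots → ℂ)

theorem tensorRefl_mul_tensorDerivComplex (a : D.affineRoots) (x : HHat V) :
    tensorRefl π k a * tensorDerivComplex V M x =
      tensorDerivComplex V M ((refl a.1).toLinearMap.baseChange ℂ x) * tensorRefl π k a -
        algebraMap ℂ _ (k a * formC a.1 x) := by
  induction x using TensorProduct.induction_on with
  | zero => simp
  | tmul z v =>
    rw [LinearMap.baseChange_tmul, tensorDerivComplex_tmul, tensorDerivComplex_tmul, formC_tmul,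
      mul_smul_comm, tensorRefl_mul_tensorDeriv, smul_sub, smul_mul_assoc,
      Algebra.algebraMap_eq_smul_one, smul_smul, mul_left_comm]
    rfl
  | add x y hx hy =>
    simp only [map_add, mul_add, add_mul, hx, hy]
    abel

theorem tensorWeyl_mul_tensorDerivComplex (w : D.extWeyl) (x : HHat V) :
    tensorWeyl π w * tensorDerivComplex V M x =
      tensorDerivComplex V M ((w : VHat V ≃ₗ[ℝ] VHat V).toLinearMap.baseChange ℂ x) *
        tensorWeyl π w := by
  induction x using TensorProduct.induction_on with
  | zero => simp
  | tmul z v =>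
    rw [LinearMap.baseChange_tmul, tensorDerivComplex_tmul, tensorDerivComplex_tmul,
      mul_smul_comm, tensorWeyl_mul_tensorDeriv, smul_mul_assoc]
    rfl
  | add x y hx hy => simp only [map_add, mul_add, add_mul, hx, hy]

/-- The integral-reflection representation exists. -/
theorem exists_integralReflection_representation (hk : AffineData.IsMultiplicity k) :
    ∃ Q : AffineData.Cherednik k →ₐ[ℂ] Module.End ℂ (TensorProduct ℂ (COmega V) M),
      (∀ a : D.affineRoots, (a : VHat V) ∈ D.simpleAffineRoots →
        Q (AffineData.Cherednik.grp k (D.affRefl a)) = tensorRefl π k a) ∧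
      (∀ w ∈ D.Omega, Q (AffineData.Cherednik.grp k w) = tensorWeyl π w) ∧
      (∀ x : HHat V, Q (AffineData.Cherednik.vec k x) = tensorDerivComplex V M x) := by
  -- `ρ` is the action of the whole extended affine Weyl group; with it, the defining relations of
  -- the algebra can be checked one by one.
  obtain ⟨ρ, hρΩ, hρ⟩ :=
    AffineData.exists_hom_of_liftRelations (liftRelations_tensorRefl π k hk)
  let L := FreeAlgebra.lift ℂ (Sum.elim (tensorDerivComplex V M) ρ)
  have hvec : ∀ x, L (FreeAlgebra.ι ℂ (Sum.inl x)) = tensorDerivComplex V M x := fun x =>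
    FreeAlgebra.lift_ι_apply _ _
  have hgrp : ∀ w, L (FreeAlgebra.ι ℂ (Sum.inr w)) = ρ w := fun w => FreeAlgebra.lift_ι_apply _ _
  have hL : ∀ ⦃x y⦄, AffineData.CherednikRel k x y → L x = L y := by
    intro x y h
    induction h with
    | vec_add x y => simp only [map_add, hvec]
    | vec_smul r x => simp only [map_smul, hvec]
    | vec_comm x y => simp only [map_mul, hvec]; exact tensorDerivComplex_comm x y
    | grp_one => simp only [map_one, hgrp]
    | grp_mul w w' => simp only [map_mul, hgrp]
    | cross_refl a ha x =>
      simp only [map_mul, map_sub, hvec, hgrp, AlgHom.commutes, hρ a ha]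
      rw [tensorRefl_mul_tensorDerivComplex, map_mul]
    | cross_Omega w hw x =>
      simp only [map_mul, hvec, hgrp, hρΩ w hw]
      exact tensorWeyl_mul_tensorDerivComplex π w x
  let Q : AffineData.Cherednik k →ₐ[ℂ] Module.End ℂ (TensorProduct ℂ (COmega V) M) :=
    RingQuot.liftAlgHom ℂ ⟨L, hL⟩
  have hQ : ∀ x, Q (AffineData.Cherednik.mk k x) = L x := fun x =>
    RingQuot.liftAlgHom_mkAlgHom_apply ℂ L hL x
  refine ⟨Q, fun a ha => ?_, fun w hw => ?_, fun x => ?_⟩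
  · exact (hQ _).trans ((hgrp _).trans (hρ a ha))
  · exact (hQ _).trans ((hgrp _).trans (hρΩ w hw))
  · exact (hQ _).trans (hvec x)

end Representation

end ExtCherednik

end

theorem mainTheorem5 {V : Type*} [NormedAddCommGroup V] [InnerProductSpace ℝ V]
    [FiniteDimensional ℝ V] (D : AffineData V)
    (k : D.affineRoots → ℂ) (hk : AffineData.IsMultiplicity k)
    {M : Type*} [AddCommGroup M] [Module ℂ M] [FiniteDimensional ℂ M]
    (π : Representation ℂ D.extWeyl M) :
    ∃! Q : AffineData.Cherednik k →ₐ[ℂ] Module.End ℂ (TensorProduct ℂ (COmega V) M),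
      (∀ a : D.affineRoots, (a : VHat V) ∈ D.simpleAffineRoots →
        Q (AffineData.Cherednik.grp k (D.affRefl a)) =
          TensorProduct.map (weylAct (D.affRefl a)) (π (D.affRefl a)) -
            k a • TensorProduct.map (integralReflection a) LinearMap.id) ∧
      (∀ w ∈ D.Omega, Q (AffineData.Cherednik.grp k w) =
        TensorProduct.map (weylAct w) (π w)) ∧
      (∀ v : VHat V, Q (AffineData.Cherednik.vec k ((1 : ℂ) ⊗ₜ[ℝ] v)) =
        TensorProduct.map (dirDeriv v) LinearMap.id) := by
  obtain ⟨Q, hs, hΩ, hv⟩ := exists_integralReflection_representation π k hk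
  refine ⟨Q, ⟨hs, hΩ, fun v => ?_⟩, fun Q' ⟨hs', hΩ', hv'⟩ => ?_⟩
  · rw [hv, tensorDerivComplex_tmul, one_smul]
    rfl
  · refine cherednik_algHom_ext k (fun a ha => (hs' a ha).trans (hs a ha).symm)
      (fun w hw => (hΩ' w hw).trans (hΩ w hw).symm) fun v => ?_
    rw [hv', hv, tensorDerivComplex_tmul, one_smul]
    rfl
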